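/- Let $n\ge 0$. Write a permutation $w$ of $\{1,\dots,n\}$ as the word $[w(1),\dots,w(n)]$, and let $w\overset{D}{\le}y$ denote the right weak order: for all $1\le i<j\le n$, if $j$ stands before $i$ in $w$, then $j$ stands before $i$ in $y$. Let $T(w)$ be the Robinson–Schensted tableau of $w$ obtained by column insertion of the letters of $w$ from the last one to the first one (equivalently, the row-insertion tableau of $w$). For a standard Young tableau $T$ with entries $1,\dots,n$ let $\mathcal C_T=\{w : T(w)=T\}$ be its Young cell. Two relations on the set $\mathbf T_n$ of standard tableaux are defined as follows. * *Induced Duflo order*: $T\overset{D}{\le}S$ if there are standard tableaux $T=P_1,\dots,P_k=S$ in $\mathbf T_n$ such that for every $1\le j<k$ there are $w\in\mathcal C_{P_j}$ and $y\in\mathcal C_{P_{j+1}}$ with $w\overset{D}{\le}y$. * *Chain order*: $T\overset{C}{\le}S$ if for all $1\le i<j\le n$ the shape of $\pi_{i,j}(T)$ is less than or equal to the shape of $\pi_{i,j}(S)$ in the dominance order, where $\pi_{i,j}(T)$ is obtained from $T$ by removing the entries $1,\dots,i-1$ and $j+1,\dots,n$ by jeu de taquin, and a shape is regarded as the partition $(\lambda_1\ge\lambda_2\ge\cdots)$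 of its column lengths ($\lambda\le\mu$ iff $\lambda_1+\dots+\lambda_k\le\mu_1+\dots+\mu_k$ for all $k$). For $T\in\mathbf T_n$ with at most two columns define the word $w_T$ as follows. Put $T_{(n)}=T$. For $i=n,n-1,\dots,1$ let $T_{(i-1)}$ be obtained from $T_{(i)}$ by deleting (by inverse Robinson–Schensted column insertion) the corner containing the largest entry of $T_{(i)}$, and let $a_i$ be the entry pushed out of the tableau. Put $w_T=[a_n,a_{n-1},\dots,a_1]$. Then for all standard tableaux $T,S\in\mathbf T_n$ with at most two columns: 1. $T\overset{D}{\le}S$ if and only if $w_T\overset{D}{\le}w_S$; likewise $T\overset{D}{<}S$ if and only if $w_T\overset{D}{<}w_S$, where $<$ means "$\le$ and not equal". 2. $T\overset{D}{\le}S$ if and only if $T\overset{C}{\le}S$; that is, the induced Duflo order and the chain order coincide on standard tableaux with at most two columns. -/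

import Mathlib

namespace YoungOrder

/-! ### Permutations in word form and the right weak order -/

/-- A permutation of `{1, …, n}` in word form `[a₁, …, aₙ]`, where `aᵢ = w(i)`. -/
@[ext]
structure Word (n : ℕ) where
  letters : List ℕ
  perm : letters.Perm (List.range' 1 n)

/-- The place (counted from `0`) of the letter `m` in the word `w`, that is `w⁻¹(m)`. -/
def Word.place {n : ℕ} (w : Word n) (m : ℕ) : ℕ := w.letters.idxOf m

/-- The right weak order: every inversion (larger letter before smaller one) of `w` is one
of `y`. -/
def WeakLE {n : ℕ} (w y : Word n) : Prop :=
  ∀ i j : ℕ, 1 ≤ i → i < j → j ≤ n → w.place j < w.place i → y.place j < y.place i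

/-! ### Standard Young tableaux, written as the list of their columns -/

/-- The column `D` may stand to the right of the column `C`: it is not longer than `C`, and in
each row the entry of `C` is smaller than the entry of `D`. -/
def ColumnLT (C D : List ℕ) : Prop :=
  D.length ≤ C.length ∧ ∀ (r : ℕ) (hC : r < C.length) (hD : r < D.length), C[r] < D[r]

/-- A standard Young tableau with entries `1, …, n`, given by the list of its (nonempty) columns
from left to right; each column is listed from top to bottom. -/
@[ext]
structure StandardTableau (n : ℕ) where
  columns : List (List ℕ)
  nonempty : ∀ C ∈ columns, C ≠ []
  column_increasing : ∀ C ∈ columns, C.Pairwise (· < ·)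
  row_increasing : columns.Pairwise ColumnLT
  entries : columns.flatten.Perm (List.range' 1 n)

/-- The shape of a tableau: the list of its column lengths. -/
def shape (T : List (List ℕ)) : List ℕ := T.map List.length

/-- The dominance order on partitions (for us: lists of column lengths). -/
def DominanceLE (l m : List ℕ) : Prop := ∀ k : ℕ, (l.take k).sum ≤ (m.take k).sum

/-- The tableau has at most two columns. -/
def StandardTableau.TwoColumn {n : ℕ} (T : StandardTableau n) : Prop := T.columns.length ≤ 2

/-- Forget empty columns. -/
def dropEmpty (T : List (List ℕ)) : List (List ℕ) := T.filter fun C => !C.isEmpty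

/-! ### Robinson–Schensted insertion and the Duflo order -/

/-- Insertion `j → C` of `j` into an increasing column `C`: `j` replaces the smallest entry greater
than `j`, and this entry is bumped out; if there is none, `j` is put at the bottom. -/
def columnInsert (j : ℕ) (C : List ℕ) : List ℕ × Option ℕ :=
  match (C.filter fun a => decide (j < a)).min? with
  | none => (C ++ [j], none)
  | some a => (C.replace a j, some a)

/-- Insertion `j ⇒ T` into a tableau: the letter bumped out of a column is inserted into the
next column. -/
def tableauInsert (j : ℕ) : List (List ℕ) → List (List ℕ)
  | [] => [[j]]
  | C :: T =>
    match columnInsert j C with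
    | (C', none) => C' :: T
    | (C', some a) => C' :: tableauInsert a T

/-- The Robinson–Schensted tableau `T(w)`: the letters of `w` are inserted from the last one to
the first one. -/
def insertionTableau (w : List ℕ) : List (List ℕ) := w.foldr tableauInsert []

/-- The Young cell of `T`. -/
def youngCell {n : ℕ} (T : StandardTableau n) : Set (Word n) :=
  {w | insertionTableau w.letters = T.columns}

/-- Some word of the cell of `T` is below some word of the cell of `S` in the right weak order. -/
def DufloStep {n : ℕ} (T S : StandardTableau n) : Prop :=
  ∃ w ∈ youngCell T, ∃ y ∈ youngCell S, WeakLE w y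

/-- The Duflo order on all standard tableaux of size `n`: there is a finite sequence
`T = P₁, …, Pₖ = S` in which each two consecutive tableaux are related by `DufloStep`. -/
def DufloLE {n : ℕ} (T S : StandardTableau n) : Prop := Relation.ReflTransGen DufloStep T S

/-! ### Jeu de taquin and the chain order -/

/-- Jeu de taquin with a hole in row `r` (counted from `0`) of the first column of the given list
of columns. The smaller one of the entries below the hole and to the right of the hole moves into
the hole; if there is no such entry, the box with the hole is removed. -/
def slide : List (List ℕ) → ℕ → List (List ℕ)
  | [], _ => []
  | C :: T, r =>
    if hb : r + 1 < C.length then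
      match T.head?.bind (fun D => D[r]?) with
      | none => slide (C.set r C[r + 1] :: T) (r + 1)
      | some x =>
        if C[r + 1] < x then slide (C.set r C[r + 1] :: T) (r + 1)
        else C.set r x :: slide T r
    else
      match T.head?.bind (fun D => D[r]?) with
      | none => C.eraseIdx r :: T
      | some x => C.set r x :: slide T r
termination_by T r => (T.length, (T.head?.map List.length).getD 0 - r)
decreasing_by
  all_goals simp_wf
  all_goals first
    | (apply Prod.Lex.right; omega)
    | (apply Prod.Lex.left; omega)

/-- Make a hole at the entry `m` and slide it out. -/
def slideOut (m : ℕ) : List (List ℕ) → List (List ℕ)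
  | [] => []
  | C :: T => if m ∈ C then slide (C :: T) (C.idxOf m) else C :: slideOut m T

/-- The tableau `T ∖ {m}` obtained by removing the entry `m` by jeu de taquin. -/
def jeuDeTaquinRemove (T : List (List ℕ)) (m : ℕ) : List (List ℕ) := dropEmpty (slideOut m T)

/-- The projection `π_{i,j}(T)`: remove `n, n - 1, …, j + 1` and then `1, 2, …, i - 1` from `T`
by jeu de taquin. -/
def StandardTableau.proj {n : ℕ} (T : StandardTableau n) (i j : ℕ) : List (List ℕ) :=
  ((List.range' (j + 1) (n - j)).reverse ++ List.range' 1 (i - 1)).foldl jeuDeTaquinRemove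
    T.columns

/-- The chain order: `π_{i,j}(T)` and `π_{i,j}(S)` have comparable shapes for all `i < j`. -/
def ChainLE {n : ℕ} (T S : StandardTableau n) : Prop :=
  ∀ i j : ℕ, 1 ≤ i → i < j → j ≤ n → DominanceLE (shape (T.proj i j)) (shape (S.proj i j))

/-! ### The canonical representative of a Young cell -/

/-- The operation `C ← j`: `j` replaces the greatest entry of `C` smaller than `j`. The second
component is the entry pushed out. (In a tableau there always is such an entry; otherwise nothing is
done and `j` itself is returned.) -/
def pushLeft (C : List ℕ) (j : ℕ) : List ℕ × ℕ :=
  match (C.filter fun a => decide (a < j)).max? with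
  | none => (C, j)
  | some a => (C.replace a j, a)

/-- Deletion `T ⇐ z` of the corner with entry `z`, before empty columns are dropped: `z` is removed
from its column and pushed left through the preceding columns. The second component is the
entry pushed out of the first column (`z` itself if `z` is in the first column). -/
def deleteCorner (z : ℕ) : List (List ℕ) → List (List ℕ) × ℕ
  | [] => ([], z)
  | C :: T =>
    if z ∈ C then (C.erase z :: T, z)
    else
      ((pushLeft C (deleteCorner z T).2).1 :: (deleteCorner z T).1,
        (pushLeft C (deleteCorner z T).2).2)

/-- Starting with `T`, delete `k` times the corner which holds the largest entry, and list the
entries pushed out. -/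
def canonicalLetters : ℕ → List (List ℕ) → List ℕ
  | 0, _ => []
  | k + 1, T =>
    match T.flatten.max? with
    | none => []
    | some z =>
      (deleteCorner z T).2 :: canonicalLetters k (dropEmpty (deleteCorner z T).1)

theorem pushLeft_perm (C : List ℕ) (j : ℕ) :
    ((pushLeft C j).2 :: (pushLeft C j).1).Perm (j :: C) := by
  unfold pushLeft
  split
  · exact List.Perm.refl _
  · rename_i a ha
    have hmem : a ∈ C := (List.mem_filter.1 (List.max?_mem ha)).1
    clear ha
    induction C with
    | nil => simp at hmem
    | cons b C ih =>
      by_cases hab : b = a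
      · subst hab
        simpa [List.replace_cons] using List.Perm.swap j b C
      · have h1 : a ∈ C := by
          rcases List.mem_cons.1 hmem with h | h
          · exact absurd h.symm hab
          · exact h
        have h2 : (a == b) = false := by simpa using fun h : a = b => hab h.symm
        have h3 : (b :: C).replace a j = b :: C.replace a j := by
          rw [List.replace_cons, h2]
        simp only [h3]
        exact (List.Perm.swap b a _).trans
          (((ih h1).cons b).trans (List.Perm.swap j b C))

theorem deleteCorner_perm (z : ℕ) (T : List (List ℕ)) (hz : z ∈ T.flatten) :
    ((deleteCorner z T).2 :: (deleteCorner z T).1.flatten).Perm T.flatten := by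
  induction T with
  | nil => simp at hz
  | cons C T ih =>
    by_cases hC : z ∈ C
    · simp only [deleteCorner, hC, if_true, List.flatten_cons]
      rw [← List.cons_append]
      exact (List.perm_cons_erase hC).symm.append_right _
    · have hT : z ∈ T.flatten := by
        rw [List.flatten_cons, List.mem_append] at hz
        exact hz.resolve_left hC
      simp only [deleteCorner, hC, if_false, List.flatten_cons]
      rw [← List.cons_append]
      refine ((pushLeft_perm C _).append_right _).trans ?_
      rw [List.cons_append]
      exact List.perm_middle.symm.trans ((ih hT).append_left C)

theorem flatten_dropEmpty (T : List (List ℕ)) : (dropEmpty T).flatten = T.flatten :=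
  List.flatten_filter_not_isEmpty

theorem canonicalLetters_perm (k : ℕ) (T : List (List ℕ)) (hk : T.flatten.length = k) :
    (canonicalLetters k T).Perm T.flatten := by
  induction k generalizing T with
  | zero => simp [canonicalLetters, List.length_eq_zero_iff.1 hk]
  | succ k ih =>
    unfold canonicalLetters
    split
    · rename_i h
      rw [List.max?_eq_none_iff.1 h]
    · rename_i z h
      have hp := deleteCorner_perm z T (List.max?_mem h)
      have hl : (dropEmpty (deleteCorner z T).1).flatten.length = k := by
        rw [flatten_dropEmpty]
        have := hp.length_eq
        rw [List.length_cons] at this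
        omega
      have := ih _ hl
      rw [flatten_dropEmpty] at this
      exact (this.cons _).trans hp

/-- The canonical word `w_T = [aₙ, …, a₁]`: starting with `T`, one deletes again and again the
corner which holds the largest entry; `aₙ, aₙ₋₁, …, a₁` are the entries pushed out one after
another. -/
def StandardTableau.canonicalWord {n : ℕ} (T : StandardTableau n) : Word n where
  letters := canonicalLetters n T.columns
  perm := (canonicalLetters_perm n T.columns
    (by rw [T.entries.length_eq, List.length_range'])).trans T.entries

end YoungOrder

/-! One statistic carries the proof: the length of a longest decreasing subsequence with letters in
`[i, j)`. It depends only on the insertion tableau. For columns `C`, `D` it is the maximum over cuts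
`y` in `[i, j]` of `cnt C y j + cnt D i y`, and `Bnd` says that this maximum is at most `k`
(`Inserts.bnd_iff`).

Duflo implies chain: going up in the weak order keeps inversions, so the statistic can only grow,
and it creates no increasing subsequences, so two-column tableaux stay two-column. Jeu de taquin
preserves `Bnd` on intervals without the removed entry (`exists_remove_min`, `exists_remove_max`).
For a tableau with all entries in the interval, the statistic is the length of the first column.
Hence the chain order compares the statistic on intervals (`chainLE_iff`).

Chain implies weak order of canonical words: read the entries from the largest down. Entries of the
second column join a queue; an entry of the first column takes the head of the queue as its partner,
or stands alone if the queue is empty. The canonical word lists these pairs and single letters. So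
`p < q` stand in this order exactly when `p ∈ C`, `q ∈ D` and `p` is at least the partner of `q`,
which is a counting condition (`IsCanonical.pair_sublist_iff`). It passes from `S` to `T` by
`mem_snd_of_bnd` and `mem_fst_of_bnd`. Both use an interval of `2k` letters in which `S` has `k`
letters in each column and statistic `k`: an end letter in the wrong column of `T` would give a
decreasing subsequence of length `k + 1`.

Canonical words lie in their cells, so their comparison is a single Duflo step, which closes the
cycle. They also determine their tableaux, which gives the strict version. -/

namespace YoungOrder

/-! ### Counting entries in half-open intervals -/

/-- The number of entries of `C` in the interval `[a, b)`. -/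
def cnt (C : List ℕ) (a b : ℕ) : ℕ := C.countP fun z => decide (a ≤ z ∧ z < b)

@[simp] theorem cnt_nil (a b : ℕ) : cnt [] a b = 0 := rfl

theorem cnt_cons (x : ℕ) (C : List ℕ) (a b : ℕ) :
    cnt (x :: C) a b = cnt C a b + if a ≤ x ∧ x < b then 1 else 0 := by
  simp [cnt, List.countP_cons]

theorem cnt_append (C D : List ℕ) (a b : ℕ) : cnt (C ++ D) a b = cnt C a b + cnt D a b := by
  simp [cnt, List.countP_append]

theorem cnt_concat (x : ℕ) (C : List ℕ) (a b : ℕ) :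
    cnt (C ++ [x]) a b = cnt C a b + if a ≤ x ∧ x < b then 1 else 0 := by
  rw [cnt_append, cnt_cons, cnt_nil, zero_add]

theorem cnt_perm {C D : List ℕ} (h : C.Perm D) (a b : ℕ) : cnt C a b = cnt D a b :=
  h.countP_eq _

theorem cnt_split (C : List ℕ) {a b c : ℕ} (hab : a ≤ b) (hbc : b ≤ c) :
    cnt C a b + cnt C b c = cnt C a c := by
  induction C with
  | nil => rfl
  | cons x C ih => simp only [cnt_cons]; split_ifs <;> omega

theorem cnt_eq_zero {C : List ℕ} {a b : ℕ} (h : ∀ z ∈ C, a ≤ z → b ≤ z) : cnt C a b = 0 := by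
  simp only [cnt, List.countP_eq_zero, decide_eq_true_eq]
  intro z hz h1
  have := h z hz h1.1
  omega

theorem cnt_self (C : List ℕ) (a : ℕ) : cnt C a a = 0 := cnt_eq_zero fun _ _ h => h

theorem cnt_pos_iff {C : List ℕ} {a b : ℕ} : 0 < cnt C a b ↔ ∃ z ∈ C, a ≤ z ∧ z < b := by
  simp [cnt, List.countP_pos_iff]

theorem cnt_eq_length {C : List ℕ} {a b : ℕ} (h : ∀ z ∈ C, a ≤ z ∧ z < b) :
    cnt C a b = C.length := by
  rw [cnt, List.countP_eq_length]
  simpa using h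

theorem cnt_mono (C : List ℕ) {a b a' b' : ℕ} (ha : a' ≤ a) (hb : b ≤ b') :
    cnt C a b ≤ cnt C a' b' := by
  apply List.countP_mono_left
  intro x _ h
  simp only [decide_eq_true_eq] at *
  omega

theorem cnt_succ_le_one {C : List ℕ} (hC : C.Nodup) (a : ℕ) : cnt C a (a + 1) ≤ 1 := by
  refine le_trans (le_of_eq ?_) (List.nodup_iff_count_le_one.1 hC a)
  rw [cnt, List.count]
  refine List.countP_congr fun z _ => ?_
  simp only [decide_eq_true_eq, beq_iff_eq]
  omega

/-- The longest decreasing subsequence of the word `C` reversed followed by `D` reversed with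
letters in `[i, j)` has at most `k` letters, for increasing lists `C` and `D`. -/
def Bnd (C D : List ℕ) (i j k : ℕ) : Prop :=
  ∀ y, i ≤ y → y ≤ j → cnt C y j + cnt D i y ≤ k

/-! ### Decreasing subsequences of words -/

/-- The length of the longest decreasing subsequence of `w` with letters in `[i, j)`. -/
def decLength : List ℕ → ℕ → ℕ → ℕ
  | [], _, _ => 0
  | a :: w, i, j =>
    if i ≤ a ∧ a < j then max (decLength w i j) (decLength w i a + 1) else decLength w i j

/-- If the first letter `a` is used, it is the largest, so the remaining letters lie below it and
the upper bound drops from `j` to `a`. -/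
theorem exists_decreasing_sublist (w : List ℕ) (i j : ℕ) :
    ∃ s : List ℕ, s.Sublist w ∧ s.Pairwise (· > ·) ∧ (∀ x ∈ s, i ≤ x ∧ x < j) ∧
      s.length = decLength w i j := by
  induction w generalizing j with
  | nil => exact ⟨[], by simp [decLength]⟩
  | cons a w ih =>
    obtain ⟨s, hs, hp, hm, hl⟩ := ih j
    obtain ⟨t, ht, hp', hm', hl'⟩ := ih a
    by_cases h : i ≤ a ∧ a < j
    · by_cases hlt : decLength w i j ≤ decLength w i a + 1
      · refine ⟨a :: t, ht.cons_cons a, ?_, ?_, ?_⟩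
        · exact List.pairwise_cons.2 ⟨fun x hx => (hm' x hx).2, hp'⟩
        · intro x hx
          rcases List.mem_cons.1 hx with rfl | hx
          · exact h
          · have := hm' x hx
            omega
        · simp only [decLength, h, and_self, if_true, List.length_cons, hl']
          omega
      · refine ⟨s, hs.cons a, hp, hm, ?_⟩
        simp only [decLength, h, and_self, if_true, hl]
        omega
    · exact ⟨s, hs.cons a, hp, hm, by simp only [decLength, h, if_false, hl]⟩

theorem length_le_decLength {w s : List ℕ} (hs : s.Sublist w) {i j : ℕ}
    (hp : s.Pairwise (· > ·)) (hm : ∀ x ∈ s, i ≤ x ∧ x < j) : s.length ≤ decLength w i j := by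
  induction hs generalizing j with
  | slnil => simp
  | @cons s w a hs ih =>
    have := ih hp hm
    simp only [decLength]
    split_ifs <;> omega
  | @cons_cons s w a hs ih =>
    obtain ⟨h1, h2⟩ := List.pairwise_cons.1 hp
    have ha := hm a List.mem_cons_self
    have := ih (j := a) h2 fun x hx => ⟨(hm x (List.mem_cons_of_mem _ hx)).1, h1 x hx⟩
    simp only [decLength, ha, and_self, if_true, List.length_cons]
    omega

/-! ### The weak order and subsequences -/

theorem pair_sublist_cons {a p q : ℕ} {w : List ℕ} :
    [p, q].Sublist (a :: w) ↔ [p, q].Sublist w ∨ p = a ∧ q ∈ w := by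
  rw [List.sublist_cons_iff]
  constructor
  · rintro (h | ⟨r, hr, h⟩)
    · exact Or.inl h
    · obtain ⟨rfl, rfl⟩ := List.cons.inj hr
      exact Or.inr ⟨rfl, by simpa using h⟩
  · rintro (h | ⟨rfl, h⟩)
    · exact Or.inl h
    · exact Or.inr ⟨[q], rfl, by simpa using h⟩

theorem pair_sublist_iff_idxOf {w : List ℕ} (hw : w.Nodup) {p q : ℕ} (hp : p ∈ w) (hq : q ∈ w) :
    [p, q].Sublist w ↔ w.idxOf p < w.idxOf q := by
  induction w with
  | nil => simp at hp
  | cons a w ih =>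
    obtain ⟨ha, hw⟩ := List.nodup_cons.1 hw
    rw [pair_sublist_cons]
    by_cases hpa : p = a
    · subst hpa
      by_cases hqp : q = p
      · subst hqp
        simp only [ha, and_false, or_false, lt_irrefl, iff_false]
        exact fun h => ha (h.subset List.mem_cons_self)
      · have hqw := (List.mem_cons.1 hq).resolve_left hqp
        simp [hqw, List.idxOf_cons_ne _ (Ne.symm hqp)]
    · have hpw := (List.mem_cons.1 hp).resolve_left hpa
      by_cases hqa : q = a
      · subst hqa
        simp only [hpa, false_and, or_false, List.idxOf_cons_self, not_lt_zero, iff_false]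
        exact fun h => ha (h.subset (by simp))
      · have hqw := (List.mem_cons.1 hq).resolve_left hqa
        rw [ih hw hpw hqw, List.idxOf_cons_ne _ (Ne.symm hpa), List.idxOf_cons_ne _ (Ne.symm hqa)]
        simp [hpa]

/-- Both `s` and the subword of `w` with the letters of `s` are sorted by "stands before in `w`".
This relation is antisymmetric on the letters of `w`, so the two lists, being permutations of each
other, agree. -/
theorem sublist_of_pairwise {w s : List ℕ} (hw : w.Nodup) (hs : s.Nodup) (hsub : ∀ x ∈ s, x ∈ w)
    (h : s.Pairwise fun a b => [a, b].Sublist w) : s.Sublist w := by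
  have hperm : s.Perm (w.filter fun x => decide (x ∈ s)) := by
    rw [List.perm_ext_iff_of_nodup hs (hw.filter _)]
    intro a
    simp only [List.mem_filter, decide_eq_true_eq]
    exact ⟨fun ha => ⟨hsub a ha, ha⟩, fun ha => ha.2⟩
  have hsorted : (w.filter fun x => decide (x ∈ s)).Pairwise fun a b => [a, b].Sublist w :=
    List.pairwise_iff_forall_sublist.2 fun hab => hab.trans List.filter_sublist
  have : s = w.filter fun x => decide (x ∈ s) := by
    refine hperm.eq_of_pairwise ?_ h hsorted
    intro a b ha hb hab hba
    have ha' := hsub a ha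
    have hb' := (List.mem_filter.1 hb).1
    rw [pair_sublist_iff_idxOf hw ha' hb'] at hab
    rw [pair_sublist_iff_idxOf hw hb' ha'] at hba
    omega
  rw [this]
  exact List.filter_sublist

theorem Word.nodup {n : ℕ} (w : Word n) : w.letters.Nodup :=
  w.perm.nodup_iff.2 List.nodup_range'

theorem Word.mem_letters {n : ℕ} (w : Word n) {m : ℕ} : m ∈ w.letters ↔ 1 ≤ m ∧ m ≤ n := by
  rw [w.perm.mem_iff, List.mem_range'_1]
  omega

theorem WeakLE.sublist_of_gt {n : ℕ} {w y : Word n} (h : WeakLE w y) {p q : ℕ} (hqp : q < p)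
    (hpq : [p, q].Sublist w.letters) : [p, q].Sublist y.letters := by
  have hp : p ∈ w.letters := hpq.subset (by simp)
  have hq : q ∈ w.letters := hpq.subset (by simp)
  rw [pair_sublist_iff_idxOf w.nodup hp hq] at hpq
  rw [w.mem_letters] at hp hq
  rw [pair_sublist_iff_idxOf y.nodup (y.mem_letters.2 hp) (y.mem_letters.2 hq)]
  exact h q p hq.1 hqp hp.2 hpq

/-- The complementary form of the weak order; non-inversions are what can be described well for
canonical words. -/
theorem weakLE_iff_sublist {n : ℕ} {w y : Word n} :
    WeakLE w y ↔ ∀ p q, p < q → [p, q].Sublist y.letters → [p, q].Sublist w.letters := by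
  constructor
  · intro h p q hpq hy
    have hp : p ∈ y.letters := hy.subset (by simp)
    have hq : q ∈ y.letters := hy.subset (by simp)
    rw [pair_sublist_iff_idxOf y.nodup hp hq] at hy
    rw [y.mem_letters] at hp hq
    have hp' := w.mem_letters.2 hp
    rw [pair_sublist_iff_idxOf w.nodup hp' (w.mem_letters.2 hq)]
    have h1 : ¬ w.letters.idxOf q < w.letters.idxOf p := fun h' => by
      have := h p q hp.1 hpq hq.2 h'
      simp only [Word.place] at this
      omega
    have h2 : w.letters.idxOf p ≠ w.letters.idxOf q := fun h' => by
      have := (List.idxOf_inj hp').1 h'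
      omega
    omega
  · intro h i j hi hij hj hw
    have hi' : 1 ≤ i ∧ i ≤ n := by omega
    have hj' : 1 ≤ j ∧ j ≤ n := by omega
    by_contra hy
    have hne : y.letters.idxOf i ≠ y.letters.idxOf j := fun h' => by
      have := (List.idxOf_inj (y.mem_letters.2 hi')).1 h'
      omega
    have hlt : y.letters.idxOf i < y.letters.idxOf j := by
      simp only [Word.place] at hy
      omega
    have := h i j hij
      ((pair_sublist_iff_idxOf y.nodup (y.mem_letters.2 hi') (y.mem_letters.2 hj')).2 hlt)
    rw [pair_sublist_iff_idxOf w.nodup (w.mem_letters.2 hi') (w.mem_letters.2 hj')] at this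
    simp only [Word.place] at hw
    omega

theorem WeakLE.decLength_le {n : ℕ} {w y : Word n} (h : WeakLE w y) (i j : ℕ) :
    decLength w.letters i j ≤ decLength y.letters i j := by
  obtain ⟨s, hs, hp, hm, hl⟩ := exists_decreasing_sublist w.letters i j
  rw [← hl]
  refine length_le_decLength (sublist_of_pairwise y.nodup (hp.imp fun h => ne_of_gt h) ?_ ?_) hp hm
  · intro x hx
    exact y.mem_letters.2 (w.mem_letters.1 (hs.subset hx))
  · refine List.pairwise_iff_forall_sublist.2 fun {a b} hab => ?_
    exact h.sublist_of_gt (List.pairwise_iff_forall_sublist.1 hp hab) (hab.trans hs)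

theorem WeakLE.increasing_sublist {n : ℕ} {w y : Word n} (h : WeakLE w y) {s : List ℕ}
    (hs : s.Pairwise (· < ·)) (hy : s.Sublist y.letters) : s.Sublist w.letters := by
  refine sublist_of_pairwise w.nodup (hs.imp fun h => ne_of_lt h) ?_ ?_
  · intro x hx
    exact w.mem_letters.2 (y.mem_letters.1 (hy.subset hx))
  · refine List.pairwise_iff_forall_sublist.2 fun {a b} hab => ?_
    exact weakLE_iff_sublist.1 h a b (List.pairwise_iff_forall_sublist.1 hs hab) (hab.trans hy)

/-! ### Insertion into tableaux with at most two columns -/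

theorem columnInsert_of_forall_not_lt {a : ℕ} {C : List ℕ} (h : ∀ x ∈ C, ¬ a < x) :
    columnInsert a C = (C ++ [a], none) := by
  have : (C.filter fun x => decide (a < x)) = [] := by
    rw [List.filter_eq_nil_iff]
    simpa using h
  simp [columnInsert, this]

theorem columnInsert_of_min {a b : ℕ} {C : List ℕ} (hb : b ∈ C) (hab : a < b)
    (hmin : ∀ x ∈ C, a < x → b ≤ x) : columnInsert a C = (C.replace b a, some b) := by
  have : (C.filter fun x => decide (a < x)).min? = some b := by
    rw [List.min?_eq_some_iff]
    simp only [List.mem_filter, decide_eq_true_eq]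
    exact ⟨⟨hb, hab⟩, fun x hx => hmin x hx.1 hx.2⟩
  simp [columnInsert, this]

theorem exists_min_gt {a : ℕ} {C : List ℕ} (h : ∃ x ∈ C, a < x) :
    ∃ b ∈ C, a < b ∧ ∀ x ∈ C, a < x → b ≤ x := by
  classical
  have hex : ∃ b, b ∈ C ∧ a < b := h
  exact ⟨Nat.find hex, (Nat.find_spec hex).1, (Nat.find_spec hex).2,
    fun x hx hax => Nat.find_min' hex ⟨hx, hax⟩⟩

theorem replace_perm {a b : ℕ} {C : List ℕ} (h : b ∈ C) :
    (b :: C.replace b a).Perm (a :: C) := by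
  induction C with
  | nil => simp at h
  | cons c C ih =>
    by_cases hcb : b = c
    · subst hcb
      simpa [List.replace_cons] using List.Perm.swap a b C
    · have h1 := (List.mem_cons.1 h).resolve_left hcb
      have h2 : (c :: C).replace b a = c :: C.replace b a := by
        rw [List.replace_cons, beq_false_of_ne hcb]
      rw [h2]
      exact (List.Perm.swap c b _).trans (((ih h1).cons c).trans (List.Perm.swap a c C))

theorem tableauInsert_length_le (a : ℕ) (T : List (List ℕ)) :
    T.length ≤ (tableauInsert a T).length := by
  induction T generalizing a with
  | nil => simp
  | cons C T ih =>
    rw [tableauInsert]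
    split
    · simp
    · simpa using ih _

theorem exists_tableauInsert_cons {a : ℕ} {C : List ℕ} {T : List (List ℕ)}
    (h : ∃ x ∈ C, a < x) : ∃ b ∈ C, a < b ∧ (∀ x ∈ C, a < x → b ≤ x) ∧
      tableauInsert a (C :: T) = C.replace b a :: tableauInsert b T := by
  obtain ⟨b, hb, hab, hmin⟩ := exists_min_gt h
  refine ⟨b, hb, hab, hmin, ?_⟩
  rw [tableauInsert, columnInsert_of_min hb hab hmin]

theorem dropEmpty_pair {C D : List ℕ} (hC : C ≠ []) (hD : D ≠ []) :
    dropEmpty [C, D] = [C, D] := by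
  simp [dropEmpty, hC, hD]

theorem dropEmpty_single {C : List ℕ} (hC : C ≠ []) : dropEmpty [C, []] = [C] := by
  simp [dropEmpty, hC]

theorem tableauInsert_append {a : ℕ} {C D : List ℕ} (h : ∀ x ∈ C, ¬ a < x)
    (hCD : C = [] → D = []) :
    tableauInsert a (dropEmpty [C, D]) = dropEmpty [C ++ [a], D] := by
  by_cases hC : C = []
  · rw [hCD hC, hC]
    rfl
  · by_cases hD : D = []
    · subst hD
      rw [dropEmpty_single hC, dropEmpty_single (by simp), tableauInsert,
        columnInsert_of_forall_not_lt h]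
    · rw [dropEmpty_pair hC hD, dropEmpty_pair (by simp) hD, tableauInsert,
        columnInsert_of_forall_not_lt h]

theorem tableauInsert_bump {a b : ℕ} {C D : List ℕ} (hb : b ∈ C) (hab : a < b)
    (hmin : ∀ x ∈ C, a < x → b ≤ x) (hD : ∀ x ∈ D, ¬ b < x) :
    tableauInsert a (dropEmpty [C, D]) = dropEmpty [C.replace b a, D ++ [b]] := by
  have hC : C ≠ [] := List.ne_nil_of_mem hb
  have hC' : C.replace b a ≠ [] := by
    intro h
    have := congrArg List.length h
    simp at this
    exact hC this
  rw [dropEmpty_pair hC' (by simp)]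
  by_cases hD0 : D = []
  · subst hD0
    rw [dropEmpty_single hC, tableauInsert, columnInsert_of_min hb hab hmin]
    rfl
  · rw [dropEmpty_pair hC hD0, tableauInsert, columnInsert_of_min hb hab hmin]
    simp only [tableauInsert, columnInsert_of_forall_not_lt hD]

/-- The entry bumped out of `C` is at most `c`, hence below `d`, and bumps a second time. -/
theorem three_le_length_tableauInsert {a : ℕ} {C D : List ℕ} (h : ∃ c ∈ C, ∃ d ∈ D, a < c ∧ c < d) :
    3 ≤ (tableauInsert a (dropEmpty [C, D])).length := by
  obtain ⟨c, hc, d, hd, hac, hcd⟩ := h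
  rw [dropEmpty_pair (List.ne_nil_of_mem hc) (List.ne_nil_of_mem hd)]
  obtain ⟨b, hb, hab, hmin, heq⟩ :=
    exists_tableauInsert_cons (T := [D]) (⟨c, hc, hac⟩ : ∃ x ∈ C, a < x)
  have hbc := hmin c hc hac
  obtain ⟨b', hb', -, -, heq'⟩ :=
    exists_tableauInsert_cons (T := []) (⟨d, hd, by omega⟩ : ∃ x ∈ D, b < x)
  rw [heq, heq']
  simp [tableauInsert]

/-- `C` and `D` hold the same entries as the columns of the insertion tableau of `w`, which has at
most two columns. -/
inductive Inserts : List ℕ → List ℕ → List ℕ → Prop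
  | nil : Inserts [] [] []
  | append {w C D : List ℕ} {a : ℕ} : Inserts w C D → (∀ x ∈ C, x < a) → Inserts (a :: w) (C ++ [a]) D
  | bump {w C C' D : List ℕ} {a b : ℕ} : Inserts w C D → b ∈ C → a < b →
      (∀ x ∈ C, x < a ∨ b ≤ x) → (∀ x ∈ D, x < b) → (b :: C').Perm (a :: C) →
      Inserts (a :: w) C' (D ++ [b])

theorem Inserts.perm {w C D : List ℕ} (h : Inserts w C D) : (C ++ D).Perm w := by
  induction h with
  | nil => rfl
  | @append w C D a _ _ ih =>
    rw [List.append_assoc, List.singleton_append]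
    exact List.perm_middle.trans (ih.cons a)
  | @bump w C C' D a b _ _ _ _ _ hp ih =>
    rw [← List.append_assoc]
    refine (List.perm_append_singleton b (C' ++ D)).trans ?_
    rw [← List.cons_append]
    exact (hp.append_right D).trans (ih.cons a)

theorem exists_inserts {w : List ℕ} (hw : w.Nodup) (hlen : (insertionTableau w).length ≤ 2) :
    ∃ C D, Inserts w C D ∧ (C = [] → D = []) ∧ insertionTableau w = dropEmpty [C, D] := by
  induction w with
  | nil => exact ⟨[], [], .nil, fun _ => rfl, rfl⟩
  | cons a w ih =>
    obtain ⟨ha, hw⟩ := List.nodup_cons.1 hw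
    have heq : insertionTableau (a :: w) = tableauInsert a (insertionTableau w) := rfl
    obtain ⟨C, D, hins, hCD, hT⟩ := ih hw ((tableauInsert_length_le a _).trans (heq ▸ hlen))
    rw [heq, hT] at hlen
    rw [heq, hT]
    have hperm := hins.perm
    have haC : a ∉ C := fun h => ha (hperm.subset (List.mem_append_left D h))
    by_cases hC : ∃ x ∈ C, a < x
    · obtain ⟨b, hb, hab, hmin⟩ := exists_min_gt hC
      have hbD : b ∉ D := by
        intro h
        exact (List.nodup_append.1 (hperm.nodup_iff.2 hw)).2.2 b hb b h rfl
      have hD : ∀ x ∈ D, ¬ b < x := by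
        intro d hd hbd
        have := three_le_length_tableauInsert ⟨b, hb, d, hd, hab, hbd⟩
        omega
      refine ⟨C.replace b a, D ++ [b], .bump hins hb hab ?_ ?_ (replace_perm hb), ?_,
        tableauInsert_bump hb hab hmin hD⟩
      · intro x hx
        have : x ≠ a := fun h => haC (h ▸ hx)
        by_cases hax : a < x
        · exact Or.inr (hmin x hx hax)
        · omega
      · intro x hx
        have : x ≠ b := fun h => hbD (h ▸ hx)
        have := hD x hx
        omega
      · intro h
        have := congrArg List.length h
        simp at this
        simp [this] at hb
    · push Not at hC
      refine ⟨C ++ [a], D, .append hins ?_, by simp,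
        tableauInsert_append (fun x hx => not_lt.2 (hC x hx)) hCD⟩
      intro x hx
      have : x ≠ a := fun h => haC (h ▸ hx)
      have := hC x hx
      omega

/-- The right side is the condition for the insertion of `x` to open a third column; the left side
completes `x` to an increasing subsequence of three letters. -/
theorem Inserts.exists_pair_iff {w C D : List ℕ} (h : Inserts w C D) (hw : w.Nodup) (x : ℕ) :
    (∃ p q, x < p ∧ p < q ∧ [p, q].Sublist w) ↔ ∃ c ∈ C, ∃ d ∈ D, x < c ∧ c < d := by
  induction h with
  | nil => simp
  | @append w C D a hins hC ih =>
    have ih := ih (List.nodup_cons.1 hw).2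
    have hmem : ∀ z, z ∈ w ↔ z ∈ C ∨ z ∈ D := fun z => by
      rw [← hins.perm.mem_iff, List.mem_append]
    constructor
    · rintro ⟨p, q, hxp, hpq, hs⟩
      rcases pair_sublist_cons.1 hs with hs | ⟨rfl, hq⟩
      · obtain ⟨c, hc, d, hd, h⟩ := ih.1 ⟨p, q, hxp, hpq, hs⟩
        exact ⟨c, List.mem_append_left _ hc, d, hd, h⟩
      · refine ⟨p, by simp, q, ?_, hxp, hpq⟩
        refine ((hmem q).1 hq).resolve_left fun h => ?_
        have := hC q h
        omega
    · rintro ⟨c, hc, d, hd, hxc, hcd⟩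
      rcases List.mem_append.1 hc with hc | hc
      · obtain ⟨p, q, h1, h2, h3⟩ := ih.2 ⟨c, hc, d, hd, hxc, hcd⟩
        exact ⟨p, q, h1, h2, h3.cons a⟩
      · obtain rfl := List.mem_singleton.1 hc
        exact ⟨c, d, hxc, hcd, pair_sublist_cons.2 (Or.inr ⟨rfl, (hmem d).2 (Or.inr hd)⟩)⟩
  | @bump w C C' D a b hins hb hab hC hD hp ih =>
    obtain ⟨haw, hw⟩ := List.nodup_cons.1 hw
    have ih := ih hw
    have hmem : ∀ z, z ∈ w ↔ z ∈ C ∨ z ∈ D := fun z => by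
      rw [← hins.perm.mem_iff, List.mem_append]
    have hmem' : ∀ z, z = b ∨ z ∈ C' ↔ z = a ∨ z ∈ C := fun z => by
      simpa using hp.mem_iff (a := z)
    have hbC' : b ∉ C' := by
      have : (a :: C).Nodup := by
        refine List.nodup_cons.2 ⟨fun h => haw ((hmem a).2 (Or.inl h)), ?_⟩
        exact (List.nodup_append.1 (hins.perm.nodup_iff.2 hw)).1
      exact (List.nodup_cons.1 (hp.nodup_iff.2 this)).1
    have haC' : a ∈ C' := ((hmem' a).2 (Or.inl rfl)).resolve_left hab.ne
    constructor
    · rintro ⟨p, q, hxp, hpq, hs⟩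
      rcases pair_sublist_cons.1 hs with hs | ⟨rfl, hq⟩
      · obtain ⟨c, hc, d, hd, hxc, hcd⟩ := ih.1 ⟨p, q, hxp, hpq, hs⟩
        -- The bumped entry exceeds all of `D`, so no old pair is lost with it.
        have hcb : c ≠ b := by
          have := hD d hd
          omega
        exact ⟨c, ((hmem' c).2 (Or.inr hc)).resolve_left hcb, d, List.mem_append_left _ hd, hxc, hcd⟩
      · exact ⟨p, haC', b, by simp, hxp, hab⟩
    · rintro ⟨c, hc, d, hd, hxc, hcd⟩
      by_cases hxa : x < a
      · exact ⟨a, b, hxa, hab, pair_sublist_cons.2 (Or.inr ⟨rfl, (hmem b).2 (Or.inl hb)⟩)⟩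
      · have hcC : c ∈ C := ((hmem' c).1 (Or.inr hc)).resolve_left (by omega)
        have hcb : c ≠ b := fun h => hbC' (h ▸ hc)
        rcases List.mem_append.1 hd with hd | hd
        · obtain ⟨p, q, h1, h2, h3⟩ := ih.2 ⟨c, hcC, d, hd, hxc, hcd⟩
          exact ⟨p, q, h1, h2, h3.cons a⟩
        · obtain rfl := List.mem_singleton.1 hd
          have := hC c hcC
          omega

theorem triple_sublist_cons {a p q r : ℕ} {w : List ℕ} :
    [p, q, r].Sublist (a :: w) ↔ [p, q, r].Sublist w ∨ p = a ∧ [q, r].Sublist w := by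
  rw [List.sublist_cons_iff]
  constructor
  · rintro (h | ⟨t, ht, h⟩)
    · exact Or.inl h
    · obtain ⟨rfl, rfl⟩ := List.cons.inj ht
      exact Or.inr ⟨rfl, h⟩
  · rintro (h | ⟨rfl, h⟩)
    · exact Or.inl h
    · exact Or.inr ⟨[q, r], rfl, h⟩

/-- The insertion tableau has at most two columns if and only if there is no increasing subsequence
with three letters. -/
theorem insertionTableau_length_le_two_iff {w : List ℕ} (hw : w.Nodup) :
    (insertionTableau w).length ≤ 2 ↔ ∀ p q r, p < q → q < r → ¬ [p, q, r].Sublist w := by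
  induction w with
  | nil => simp [insertionTableau]
  | cons a w ih =>
    have hw' := (List.nodup_cons.1 hw).2
    have heq : insertionTableau (a :: w) = tableauInsert a (insertionTableau w) := rfl
    constructor
    · intro hlen p q r hpq hqr hs
      have hlen' := (tableauInsert_length_le a _).trans (heq ▸ hlen)
      rcases triple_sublist_cons.1 hs with hs | ⟨hpa, hs'⟩
      · exact (ih hw').1 hlen' p q r hpq hqr hs
      · obtain ⟨C, D, hins, -, hT⟩ := exists_inserts hw' hlen'
        subst hpa
        have := three_le_length_tableauInsert
          ((hins.exists_pair_iff hw' p).1 ⟨q, r, hpq, hqr, hs'⟩)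
        rw [heq, hT] at hlen
        omega
    · intro h
      have hlen' := (ih hw').2 fun p q r hpq hqr hs => h p q r hpq hqr (hs.cons a)
      obtain ⟨C, D, hins, hCD, hT⟩ := exists_inserts hw' hlen'
      rw [heq, hT]
      have hle : ∀ E F : List ℕ, (dropEmpty [E, F]).length ≤ 2 := fun E F =>
        List.length_filter_le _ _
      by_cases hC : ∃ x ∈ C, a < x
      · obtain ⟨b, hb, hab, hmin⟩ := exists_min_gt hC
        rw [tableauInsert_bump hb hab hmin]
        · exact hle _ _
        · intro d hd hbd
          obtain ⟨p, q, h1, h2, h3⟩ := (hins.exists_pair_iff hw' a).2 ⟨b, hb, d, hd, hab, hbd⟩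
          exact h a p q h1 h2 (triple_sublist_cons.2 (Or.inr ⟨rfl, h3⟩))
      · push Not at hC
        rw [tableauInsert_append (fun x hx => not_lt.2 (hC x hx)) hCD]
        exact hle _ _

/-- A new first letter `a` either goes unused or is followed by letters below it. The claim `key`
shows that insertion changes `Bnd` by this same recursion. -/
theorem Inserts.bnd_iff {w C D : List ℕ} (h : Inserts w C D) (hw : w.Nodup) {i j k : ℕ}
    (hij : i ≤ j) :
    Bnd C D i j k ↔ decLength w i j ≤ k := by
  induction h generalizing j k with
  | nil => simp [Bnd, decLength]
  | @append w C D a hins hC ih =>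
    have ih := @ih (List.nodup_cons.1 hw).2
    have key : Bnd (C ++ [a]) D i j k ↔
        Bnd C D i j k ∧ (i ≤ a → a < j → ∃ l, l + 1 = k ∧ Bnd C D i a l) := by
      have h0 : ∀ y, a ≤ y → cnt C y j = 0 := fun y hy =>
        cnt_eq_zero fun z hz hyz => by have := hC z hz; omega
      have h1 : ∀ y, y ≤ a → a < j → cnt C y a = cnt C y j := fun y hy haj => by
        rw [← cnt_split C hy haj.le, h0 a le_rfl, add_zero]
      constructor
      · intro h
        refine ⟨fun y hiy hyj => ?_, fun hia haj => ?_⟩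
        · have := h y hiy hyj
          rw [cnt_concat] at this
          omega
        · have ha := h a hia haj.le
          rw [cnt_concat, if_pos ⟨le_rfl, haj⟩] at ha
          -- The cut at `a` counts `a` itself, so `k` is positive and the subtraction is not
          -- truncated.
          refine ⟨k - 1, by omega, fun y hiy hya => ?_⟩
          have := h y hiy (by omega)
          rw [cnt_concat, if_pos ⟨hya, haj⟩] at this
          rw [h1 y hya haj]
          omega
      · rintro ⟨h, h'⟩ y hiy hyj
        have hy := h y hiy hyj
        rw [cnt_concat]
        split_ifs with hc
        · obtain ⟨l, rfl, hl⟩ := h' (by omega) hc.2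
          have := hl y hiy hc.1
          rw [h1 y hc.1 hc.2] at this
          omega
        · exact hy
    rw [key, decLength, ih hij]
    split_ifs with hc
    · obtain ⟨hia, haj⟩ := hc
      simp only [hia, haj, forall_const, ih hia, max_le_iff]
      exact and_congr_right fun _ =>
        ⟨fun ⟨l, hl, h⟩ => by omega, fun h => ⟨k - 1, by omega, by omega⟩⟩
    · exact and_iff_left fun h1 h2 => absurd ⟨h1, h2⟩ hc
  | @bump w C C' D a b hins hb hab hC hD hp ih =>
    have hw' := (List.nodup_cons.1 hw).2
    have ih := @ih hw'
    have hC1 : cnt C b (b + 1) ≤ 1 :=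
      cnt_succ_le_one (List.nodup_append.1 (hins.perm.nodup_iff.2 hw')).1 b
    have hcC : ∀ x y, cnt C' x y + (if x ≤ b ∧ b < y then 1 else 0)
        = cnt C x y + if x ≤ a ∧ a < y then 1 else 0 := fun x y => by
      rw [← cnt_cons, ← cnt_cons, cnt_perm hp]
    have hgap : ∀ x y, a ≤ x → y ≤ b → cnt C x y = 0 := fun x y hx hy =>
      cnt_eq_zero fun z hz hxz => by have := hC z hz; omega
    have hDb : ∀ y, b ≤ y → cnt D b y = 0 := fun y hy =>
      cnt_eq_zero fun z hz hbz => by have := hD z hz; omega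
    have hCb : 0 < cnt C b (b + 1) := cnt_pos_iff.2 ⟨b, hb, by omega⟩
    have key : Bnd C' (D ++ [b]) i j k ↔
        Bnd C D i j k ∧ (i ≤ a → a < j → ∃ l, l + 1 = k ∧ Bnd C D i a l) := by
      have hCj : b < j → cnt C b j = cnt C b (b + 1) + cnt C (b + 1) j := fun hbj =>
        (cnt_split C (by omega) hbj).symm
      constructor
      · intro h
        have hval : ∀ y, i ≤ y → y ≤ j → cnt C' y j + (cnt D i y +
            if i ≤ b ∧ b < y then 1 else 0) ≤ k := fun y h1 h2 => by
          rw [← cnt_concat]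
          exact h y h1 h2
        refine ⟨fun y hiy hyj => ?_, fun hia haj => ?_⟩
        · have hy := hval y hiy hyj
          have hcy := hcC y j
          -- These are the cuts that lose `b` without gaining `a`. The cut `b + 1` makes up for it:
          -- it counts `b` in the second column, and `C` has no entries in `[y, b)`.
          by_cases hcase : a < y ∧ y ≤ b ∧ b < j
          · have h1 := hval (b + 1) (by omega) (by omega)
            have h2 := hcC (b + 1) j
            have h3 := cnt_split C hcase.2.1 hcase.2.2.le
            have h4 := hgap y b hcase.1.le le_rfl
            have h5 := cnt_mono D (le_refl i) (show y ≤ b + 1 by omega)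
            have h6 := hCj hcase.2.2
            split_ifs at * <;> omega
          · split_ifs at * <;> omega
        · have hCa : b < j → 1 ≤ cnt C a j := fun hbj =>
            hCb.trans_le (cnt_mono C hab.le hbj)
          have ha := hval a hia haj.le
          have hca := hcC a j
          refine ⟨k - 1, by split_ifs at * <;> omega, fun y hiy hya => ?_⟩
          have hy := hval y hiy (by omega)
          have hcy := hcC y j
          have := cnt_split C hya haj.le
          split_ifs at * <;> omega
      · rintro ⟨h, h'⟩ y hiy hyj
        have hy := h y hiy hyj
        have hcy := hcC y j
        rw [cnt_concat]
        by_cases h1 : y ≤ a ∧ a < j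
        · by_cases h2 : b < j
          · split_ifs at * <;> omega
          · obtain ⟨l, rfl, hl⟩ := h' (by omega) h1.2
            have h3 := hl y hiy h1.1
            have h4 := cnt_split C h1.1 h1.2.le
            have h5 := hgap a j le_rfl (by omega)
            split_ifs at * <;> omega
        -- Above `b` the new entry of the second column adds one. The old cut at `b` pays for it:
        -- there `b` counts in `C`, and `D` has nothing from `b` on.
        · by_cases h2 : i ≤ b ∧ b < y
          · have h3 := h b h2.1 (by omega)
            have h4 := cnt_split C h2.2.le hyj
            have h5 := cnt_mono C (le_refl b) (Nat.succ_le_of_lt h2.2)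
            have h6 := cnt_split D h2.1 h2.2.le
            have h7 := hDb y h2.2.le
            simp only [Nat.succ_eq_add_one] at h5
            split_ifs at * <;> omega
          · split_ifs at * <;> omega
    rw [key, decLength, ih hij]
    split_ifs with hc
    · obtain ⟨hia, haj⟩ := hc
      simp only [hia, haj, forall_const, ih hia, max_le_iff]
      exact and_congr_right fun _ =>
        ⟨fun ⟨l, hl, h⟩ => by omega, fun h => ⟨k - 1, by omega, by omega⟩⟩
    · exact and_iff_left fun h1 h2 => absurd ⟨h1, h2⟩ hc

/-! ### Standard tableaux with two columns -/

/-- `C` and `D` are the columns of a tableau with increasing rows and columns and with distinct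
entries. The rows are increasing if and only if `D` has at most as many entries below `y` as `C`,
for all `y`. -/
structure IsStd (C D : List ℕ) : Prop where
  left : C.Pairwise (· < ·)
  right : D.Pairwise (· < ·)
  disjoint : ∀ x ∈ C, x ∉ D
  ballot : ∀ y, cnt D 0 y ≤ cnt C 0 y

theorem cnt_le_of_columnLT {C D : List ℕ} (h : ColumnLT C D) (y : ℕ) : cnt D 0 y ≤ cnt C 0 y := by
  induction D generalizing C with
  | nil => simp
  | cons d D ih =>
    obtain ⟨hl, hr⟩ := h
    cases C with
    | nil => simp at hl
    | cons c C =>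
      have h0 : c < d := hr 0 (by simp) (by simp)
      have := ih (C := C) ⟨by simpa using hl, fun r h1 h2 => by
        exact hr (r + 1) (by simpa using h1) (by simpa using h2)⟩
      rw [cnt_cons, cnt_cons]
      split_ifs <;> omega

theorem cnt_zero_eq_length {C : List ℕ} {y : ℕ} (h : ∀ z ∈ C, z < y) : cnt C 0 y = C.length :=
  cnt_eq_length fun z hz => ⟨Nat.zero_le z, h z hz⟩

theorem exists_upper_bound (C : List ℕ) : ∃ y, ∀ z ∈ C, z < y :=
  ⟨C.sum + 1, fun _ hz => Nat.lt_succ_of_le (List.single_le_sum (by simp) _ hz)⟩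

theorem IsStd.length_le {C D : List ℕ} (h : IsStd C D) : D.length ≤ C.length := by
  obtain ⟨y, hy⟩ := exists_upper_bound (C ++ D)
  rw [← cnt_zero_eq_length fun z hz => hy z (List.mem_append_left D hz),
    ← cnt_zero_eq_length fun z hz => hy z (List.mem_append_right C hz)]
  exact h.ballot y

theorem IsStd.nil_of_nil {C D : List ℕ} (h : IsStd C D) (hC : C = []) : D = [] := by
  have := h.length_le
  subst hC
  simpa using this

theorem IsStd.nodup {C D : List ℕ} (h : IsStd C D) : (C ++ D).Nodup :=
  List.nodup_append.2 ⟨h.left.imp fun h => h.ne, h.right.imp fun h => h.ne,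
    fun a ha _ hb hab => h.disjoint a ha (hab ▸ hb)⟩

/-- The first column. -/
def StandardTableau.fst {n : ℕ} (T : StandardTableau n) : List ℕ := T.columns.getD 0 []

/-- The second column. -/
def StandardTableau.snd {n : ℕ} (T : StandardTableau n) : List ℕ := T.columns.getD 1 []

theorem getD_dropEmpty {C D : List ℕ} (h : C = [] → D = []) :
    (dropEmpty [C, D]).getD 0 [] = C ∧ (dropEmpty [C, D]).getD 1 [] = D := by
  by_cases hC : C = []
  · rw [hC, h hC]
    exact ⟨rfl, rfl⟩
  · by_cases hD : D = []
    · rw [hD, dropEmpty_single hC]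
      exact ⟨rfl, rfl⟩
    · rw [dropEmpty_pair hC hD]
      exact ⟨rfl, rfl⟩

theorem StandardTableau.TwoColumn.columns_eq {n : ℕ} {T : StandardTableau n} (hT : T.TwoColumn) :
    T.columns = dropEmpty [T.fst, T.snd] := by
  unfold TwoColumn at hT
  have hne := T.nonempty
  unfold fst snd
  generalize T.columns = L at *
  match L, hT, hne with
  | [], _, _ => rfl
  | [C], _, hne => exact (dropEmpty_single (hne C (by simp))).symm
  | [C, D], _, hne => exact (dropEmpty_pair (hne C (by simp)) (hne D (by simp))).symm

theorem StandardTableau.TwoColumn.perm {n : ℕ} {T : StandardTableau n} (hT : T.TwoColumn) :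
    (T.fst ++ T.snd).Perm (List.range' 1 n) := by
  have := T.entries
  rw [hT.columns_eq, flatten_dropEmpty] at this
  simpa using this

theorem StandardTableau.TwoColumn.isStd {n : ℕ} {T : StandardTableau n} (hT : T.TwoColumn) :
    IsStd T.fst T.snd := by
  have hnd : (T.fst ++ T.snd).Nodup := hT.perm.nodup_iff.2 List.nodup_range'
  have hdis : ∀ x ∈ T.fst, x ∉ T.snd := fun x h1 h2 =>
    (List.nodup_append.1 hnd).2.2 x h1 x h2 rfl
  unfold TwoColumn at hT
  have hcol := T.column_increasing
  have hrow := T.row_increasing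
  unfold fst snd at *
  generalize T.columns = L at *
  match L, hT, hcol, hrow with
  | [], _, _, _ => exact ⟨.nil, .nil, hdis, fun _ => le_rfl⟩
  | [C], _, hcol, _ => exact ⟨hcol C (by simp), .nil, hdis, fun _ => Nat.zero_le _⟩
  | [C, D], _, hcol, hrow =>
    exact ⟨hcol C (by simp), hcol D (by simp), hdis, cnt_le_of_columnLT (by simpa using hrow)⟩

/-! ### Jeu de taquin on two columns -/

/-- The parts of two columns strictly below the hole and at or below the hole, respectively,
become the parts at or below the row of the hole after the hole was slid out. -/
def slideColumns : List ℕ → List ℕ → List ℕ × List ℕ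
  | [], [] => ([], [])
  | [], e :: E => ([e], E)
  | b :: B, [] => (b :: B, [])
  | b :: B, e :: E =>
    if b < e then (b :: (slideColumns B E).1, e :: (slideColumns B E).2) else (e :: b :: B, E)

/-- Without a right neighbour from its row downwards, the hole can only run down its own column. -/
theorem slide_shift (A B : List ℕ) (m : ℕ) (T : List (List ℕ))
    (hT : ∀ r, A.length ≤ r → (T.head?.bind fun D => D[r]?) = none) :
    slide ((A ++ m :: B) :: T) A.length = (A ++ B) :: T := by
  induction B generalizing A m with
  | nil =>
    rw [slide]
    simp [hT A.length le_rfl, List.eraseIdx_append_of_length_le]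
  | cons b B ih =>
    rw [slide, dif_pos (by simp), hT A.length le_rfl]
    have := ih (A ++ [b]) b fun r hr => hT r (by simp at hr; omega)
    simpa [List.set_append_right, List.getElem_append_right] using this

/-- The rows above the hole are never touched again, so they are carried along as `A` and `A'`. Once
the hole has crossed, the second column closes up by `slide_shift`. -/
theorem slide_pair (A A' B E : List ℕ) (m : ℕ) (hA : A'.length = A.length) :
    slide [A ++ m :: B, A' ++ E] A.length =
      [A ++ (slideColumns B E).1, A' ++ (slideColumns B E).2] := by
  have hlast : ∀ e E, slide [A' ++ e :: E] A.length = [A' ++ E] := fun e E => by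
    rw [← hA]
    exact slide_shift A' E e [] (by simp)
  have hhead : ∀ e E, (List.head? [A' ++ e :: E]).bind (fun D => D[A.length]?) = some e :=
    fun e E => by simp [← hA]
  induction B generalizing A A' E m with
  | nil =>
    cases E with
    | nil => simpa [slideColumns] using slide_shift A [] m [A'] (by simp; omega)
    | cons e E =>
      rw [slide, dif_neg (by simp), hhead]
      simp only [hlast, slideColumns]
      simp
  | cons b B ih =>
    cases E with
    | nil => simpa [slideColumns] using slide_shift A (b :: B) m [A'] (by simp; omega)
    | cons e E =>
      have hget : (A ++ m :: b :: B)[A.length + 1]'(by simp) = b := by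
        simp [List.getElem_append_right]
      rw [slide, dif_pos (by simp), hhead]
      simp only [hlast, slideColumns, hget]
      split_ifs with h
      · have hlast' : ∀ f F, slide [A' ++ [e] ++ f :: F] (A ++ [b]).length = [A' ++ [e] ++ F] :=
          fun f F => by
            have : (A ++ [b]).length = (A' ++ [e]).length := by simp [hA]
            rw [this]
            exact slide_shift (A' ++ [e]) F f [] (by simp)
        have := ih (A ++ [b]) (A' ++ [e]) E b (by simp [hA]) hlast' fun f F => by
          have : (A ++ [b]).length = (A' ++ [e]).length := by simp [hA]
          simp only [this]
          simp
        simpa using this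
      · simp

/-- At most one entry changes column, namely the `x` at which `E` first outnumbers `B`. The two
counting clauses record this tightness, which is needed to transport `Bnd`. -/
theorem slideColumns_spec {B E : List ℕ} (hB : B.Pairwise (· < ·)) (hE : E.Pairwise (· < ·))
    (hdis : ∀ x ∈ B, x ∉ E) :
    (slideColumns B E).1.Pairwise (· < ·) ∧ (slideColumns B E).2.Pairwise (· < ·) ∧
    ((slideColumns B E = (B, E) ∧ ∀ y, cnt E 0 y ≤ cnt B 0 y) ∨
      ∃ x, (slideColumns B E).1.Perm (x :: B) ∧ E.Perm (x :: (slideColumns B E).2) ∧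
        (∀ y ≤ x, cnt E 0 y ≤ cnt B 0 y) ∧ cnt E 0 (x + 1) = cnt B 0 (x + 1) + 1) := by
  induction B generalizing E with
  | nil =>
    cases E with
    | nil => exact ⟨.nil, .nil, Or.inl ⟨rfl, fun _ => le_rfl⟩⟩
    | cons e E =>
      obtain ⟨h1, h2⟩ := List.pairwise_cons.1 hE
      refine ⟨by simp [slideColumns], h2, Or.inr ⟨e, .refl _, .refl _, fun y hy => ?_, ?_⟩⟩
      · rw [cnt_cons, cnt_eq_zero fun z hz _ => by have := h1 z hz; omega, if_neg (by omega)]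
        simp
      · rw [cnt_cons, cnt_eq_zero fun z hz _ => by have := h1 z hz; omega, if_pos (by omega)]
        simp
  | cons b B ih =>
    obtain ⟨hb, hB'⟩ := List.pairwise_cons.1 hB
    cases E with
    | nil => exact ⟨hB, .nil, Or.inl ⟨rfl, fun _ => Nat.zero_le _⟩⟩
    | cons e E =>
      obtain ⟨he, hE'⟩ := List.pairwise_cons.1 hE
      by_cases hbe : b < e
      · have heq : slideColumns (b :: B) (e :: E) =
            (b :: (slideColumns B E).1, e :: (slideColumns B E).2) := by
          simp [slideColumns, hbe]
        obtain ⟨hX, hY, hcase⟩ := ih hB' hE' fun x hx hxE =>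
          hdis x (List.mem_cons_of_mem _ hx) (List.mem_cons_of_mem _ hxE)
        rw [heq]
        rcases hcase with ⟨hXY, hbal⟩ | ⟨x, hpX, hpY, hle, heq'⟩
        · rw [hXY]
          refine ⟨hB, hE, Or.inl ⟨rfl, fun y => ?_⟩⟩
          have := hbal y
          rw [cnt_cons, cnt_cons]
          split_ifs <;> omega
        · have hx : e < x := he x (hpY.symm.subset List.mem_cons_self)
          refine ⟨List.pairwise_cons.2 ⟨fun z hz => ?_, hX⟩,
            List.pairwise_cons.2 ⟨fun z hz => ?_, hY⟩, Or.inr ⟨x, ?_, ?_, fun y hy => ?_, ?_⟩⟩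
          · rcases List.mem_cons.1 (hpX.subset hz) with rfl | hz
            · omega
            · exact hb z hz
          · exact he z (hpY.symm.subset (List.mem_cons_of_mem _ hz))
          · exact (hpX.cons b).trans (List.Perm.swap _ _ _)
          · exact (hpY.cons e).trans (List.Perm.swap _ _ _)
          · have := hle y hy
            rw [cnt_cons, cnt_cons]
            split_ifs <;> omega
          · rw [cnt_cons, cnt_cons, if_pos (by omega), if_pos (by omega)]
            omega
      · have hne : b ≠ e := fun h => hdis b List.mem_cons_self (h ▸ List.mem_cons_self)
        have heq : slideColumns (b :: B) (e :: E) = (e :: b :: B, E) := by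
          simp [slideColumns, hbe]
        rw [heq]
        refine ⟨List.pairwise_cons.2 ⟨fun z hz => ?_, hB⟩, hE',
          Or.inr ⟨e, .refl _, .refl _, fun y hy => ?_, ?_⟩⟩
        · rcases List.mem_cons.1 hz with rfl | hz
          · omega
          · have := hb z hz
            omega
        · rw [cnt_cons e, cnt_eq_zero fun z hz _ => by have := he z hz; omega, if_neg (by omega)]
          omega
        · rw [cnt_cons e, cnt_eq_zero fun z hz _ => by have := he z hz; omega, if_pos (by omega),
            cnt_eq_zero (C := b :: B) fun z hz _ => ?_]
          rcases List.mem_cons.1 hz with rfl | hz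
          · omega
          · have := hb z hz
            omega

theorem jeuDeTaquinRemove_first {B E : List ℕ} {m : ℕ} :
    jeuDeTaquinRemove (dropEmpty [m :: B, E]) m =
      dropEmpty [(slideColumns B E).1, (slideColumns B E).2] := by
  unfold jeuDeTaquinRemove
  by_cases hE : E = []
  · subst hE
    rw [dropEmpty_single (by simp)]
    have h1 := slide_shift [] B m [] (by simp)
    have h2 : slideColumns B [] = (B, []) := by cases B <;> rfl
    simp only [List.nil_append, List.length_nil] at h1
    simp only [slideOut, List.mem_cons_self, if_true, List.idxOf_cons_self, h1, h2]
    simp [dropEmpty, List.filter_cons]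
  · rw [dropEmpty_pair (by simp) hE]
    have h1 := slide_pair [] [] B E m rfl
    simp only [List.nil_append, List.length_nil] at h1
    simp only [slideOut, List.mem_cons_self, if_true, List.idxOf_cons_self, h1]

/-- If `x` moves to the first column, cuts up to `x` may gain one and cuts above `x` may lose one.
The maximum is unchanged because the crossing happens where the ballot condition first fails. -/
theorem exists_remove_min {B E : List ℕ} {m : ℕ} (h : IsStd (m :: B) E) :
    ∃ C D, jeuDeTaquinRemove (dropEmpty [m :: B, E]) m = dropEmpty [C, D] ∧ IsStd C D ∧
      (C ++ D).Perm (B ++ E) ∧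
      ∀ i j k, m < i → i ≤ j → (Bnd C D i j k ↔ Bnd (m :: B) E i j k) := by
  obtain ⟨hm, hB⟩ := List.pairwise_cons.1 h.left
  obtain ⟨hX, hY, hcase⟩ := slideColumns_spec hB h.right fun x hx =>
    h.disjoint x (List.mem_cons_of_mem _ hx)
  refine ⟨_, _, jeuDeTaquinRemove_first, ?_⟩
  have hmB : ∀ i j k, m < i → (Bnd (m :: B) E i j k ↔ Bnd B E i j k) := fun i j k hmi => by
    refine forall_congr' fun y => forall_congr' fun hy => ?_
    rw [cnt_cons, if_neg (by omega), add_zero]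
  rcases hcase with ⟨heq, hbal⟩ | ⟨x, hpX, hpY, hle, heq⟩
  · rw [heq]
    exact ⟨⟨hB, h.right, fun x hx => h.disjoint x (List.mem_cons_of_mem _ hx), hbal⟩, .refl _,
      fun i j k hmi _ => (hmB i j k hmi).symm⟩
  · generalize (slideColumns B E).1 = X at *
    generalize (slideColumns B E).2 = Y at *
    have hperm : (X ++ Y).Perm (B ++ E) := by
      refine (hpX.append_right Y).trans ?_
      rw [List.cons_append]
      exact List.perm_middle.symm.trans (hpY.symm.append_left B)
    have hnd : (B ++ E).Nodup := (List.nodup_cons.1 (List.cons_append ▸ h.nodup)).2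
    have hcX : ∀ a b, cnt X a b = cnt B a b + if a ≤ x ∧ x < b then 1 else 0 := fun a b => by
      rw [← cnt_cons, cnt_perm hpX]
    have hcE : ∀ a b, cnt E a b = cnt Y a b + if a ≤ x ∧ x < b then 1 else 0 := fun a b => by
      rw [← cnt_cons, cnt_perm hpY]
    have hbal : ∀ y, cnt E 0 y ≤ cnt B 0 y + 1 := fun y => by
      have := h.ballot y
      rw [cnt_cons] at this
      split_ifs at this <;> omega
    have hxE : x ∈ E := hpY.symm.subset List.mem_cons_self
    have hxB : x ∉ B := fun hx => h.disjoint x (List.mem_cons_of_mem _ hx) hxE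
    refine ⟨⟨hX, hY, fun z h1 h2 => ?_, fun y => ?_⟩, hperm, fun i j k hmi hij => ?_⟩
    · exact (List.nodup_append.1 (hperm.nodup_iff.2 hnd)).2.2 z h1 z h2 rfl
    · have h1 := hcX 0 y
      have h2 := hcE 0 y
      have h3 := hbal y
      have h4 := hle y
      split_ifs at * <;> omega
    · rw [hmB i j k hmi]
      have hBx : cnt B x (x + 1) = 0 := cnt_eq_zero fun z hz h1 => by
        have : z ≠ x := fun h => hxB (h ▸ hz)
        omega
      have hEx : cnt E x (x + 1) = 1 := le_antisymm
        (cnt_succ_le_one (h.right.imp fun h => h.ne) x) (cnt_pos_iff.2 ⟨x, hxE, by omega⟩)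
      have hB0 := cnt_split B (Nat.zero_le x) (Nat.le_succ x)
      have hE0 := cnt_split E (Nat.zero_le x) (Nat.le_succ x)
      simp only [Nat.succ_eq_add_one] at hB0 hE0
      constructor
      · intro hb y hiy hyj
        have hy := hb y hiy hyj
        have h1 := hcX y j
        have h2 := hcE i y
        by_cases hc : i ≤ x ∧ x < y
        · have h3 := hb x hc.1 (by omega)
          have h4 := hcX x j
          have h5 := hcE i x
          have h6 := cnt_split B hc.2.le hyj
          have h7 := cnt_split E hc.1 hc.2.le
          have h8 := hbal y
          have h9 := cnt_split B (Nat.zero_le x) hc.2.le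
          have h10 := cnt_split E (Nat.zero_le x) hc.2.le
          split_ifs at * <;> omega
        · split_ifs at * <;> omega
      · intro hb y hiy hyj
        have hy := hb y hiy hyj
        have h1 := hcX y j
        have h2 := hcE i y
        -- The old cut at `x + 1` dominates the new cut at `y`, since `cnt B y (x + 1) + 1 ≤ cnt E y
        -- (x + 1)`.
        by_cases hc : y ≤ x ∧ x < j
        · have h3 := hb (x + 1) (by omega) hc.2
          have hyx : y ≤ x + 1 := by omega
          have h6 := cnt_split B hyx hc.2
          have h7 := cnt_split E hiy hyx
          have h8 := hle y hc.1
          have h9 := cnt_split B (Nat.zero_le y) hyx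
          have h10 := cnt_split E (Nat.zero_le y) hyx
          split_ifs at * <;> omega
        · split_ifs at * <;> omega

theorem exists_concat_of_max {C : List ℕ} {m : ℕ} (hC : C.Pairwise (· < ·)) (hm : m ∈ C)
    (hmax : ∀ z ∈ C, z ≤ m) : ∃ A, C = A ++ [m] ∧ ∀ z ∈ A, z < m := by
  rcases List.eq_nil_or_concat C with rfl | ⟨A, x, rfl⟩
  · simp at hm
  · rw [List.concat_eq_append] at *
    have h := (List.pairwise_append.1 hC).2.2
    have hxm := hmax x (by simp)
    have : x = m := by
      rcases List.mem_append.1 hm with hm | hm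
      · have := h m hm x (by simp)
        omega
      · exact (List.mem_singleton.1 hm).symm
    subst this
    exact ⟨A, rfl, fun z hz => h z hz x (by simp)⟩

theorem IsStd.remove_left {A D : List ℕ} {m : ℕ} (h : IsStd (A ++ [m]) D)
    (hD : ∀ z ∈ D, z < m) : IsStd A D := by
  obtain ⟨hA, -, hAm⟩ := List.pairwise_append.1 h.left
  refine ⟨hA, h.right, fun x hx => h.disjoint x (List.mem_append_left _ hx), fun y => ?_⟩
  have hy := h.ballot y
  rw [cnt_concat] at hy
  by_cases hmy : m < y
  · have hm := h.ballot m
    rw [cnt_concat, if_neg (by omega)] at hm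
    rw [cnt_zero_eq_length hD, cnt_zero_eq_length fun z hz => hAm z hz m (by simp)] at hm
    rwa [cnt_zero_eq_length fun z hz => (hD z hz).trans hmy,
      cnt_zero_eq_length fun z hz => (hAm z hz m (by simp)).trans hmy]
  · rwa [if_neg (by omega)] at hy

theorem IsStd.remove_right {C A : List ℕ} {m : ℕ} (h : IsStd C (A ++ [m])) : IsStd C A := by
  refine ⟨h.left, (List.pairwise_append.1 h.right).1,
    fun x hx hxA => h.disjoint x hx (List.mem_append_left _ hxA), fun y => ?_⟩
  have := h.ballot y
  rw [cnt_append] at this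
  omega

theorem idxOf_concat {A : List ℕ} {m : ℕ} (h : ∀ z ∈ A, z < m) :
    (A ++ [m]).idxOf m = A.length := by
  rw [List.idxOf_append_of_notMem fun hm => lt_irrefl m (h m hm), List.idxOf_cons_self, add_zero]

/-- The largest entry is a corner, so the slide only deletes it, and intervals `[i, j)` with `j ≤ m`
do not see it. -/
theorem exists_remove_max {C D : List ℕ} {m : ℕ} (h : IsStd C D) (hm : m ∈ C ++ D)
    (hmax : ∀ z ∈ C ++ D, z ≤ m) :
    ∃ C' D', jeuDeTaquinRemove (dropEmpty [C, D]) m = dropEmpty [C', D'] ∧ IsStd C' D' ∧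
      (m :: (C' ++ D')).Perm (C ++ D) ∧
      ∀ i j k, j ≤ m → (Bnd C' D' i j k ↔ Bnd C D i j k) := by
  unfold jeuDeTaquinRemove
  by_cases hmC : m ∈ C
  · obtain ⟨A, rfl, hA⟩ := exists_concat_of_max h.left hmC fun z hz =>
      hmax z (List.mem_append_left _ hz)
    have hD : ∀ z ∈ D, z < m := fun z hz => by
      have h1 := hmax z (List.mem_append_right _ hz)
      have h2 : z ≠ m := fun hz' => h.disjoint m hmC (hz' ▸ hz)
      omega
    have hstd := h.remove_left hD
    refine ⟨A, D, ?_, hstd, ?_, fun i j k hj => ?_⟩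
    · by_cases hD0 : D = []
      · subst hD0
        have := slide_shift A [] m [] (by simp)
        rw [dropEmpty_single (by simp), slideOut, if_pos hmC, idxOf_concat hA, this]
        simp [dropEmpty, List.filter_cons]
      · have := slide_shift A [] m [D] (by simpa using fun r hr => hstd.length_le.trans hr)
        rw [dropEmpty_pair (by simp) hD0, slideOut, if_pos hmC, idxOf_concat hA, this]
        simp
    · rw [List.append_assoc, List.singleton_append]
      exact List.perm_middle.symm
    · refine forall_congr' fun y => forall_congr' fun hy => forall_congr' fun hy' => ?_
      rw [cnt_concat, if_neg (by omega), add_zero]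
  · have hmD : m ∈ D := (List.mem_append.1 hm).resolve_left hmC
    obtain ⟨A, rfl, hA⟩ := exists_concat_of_max h.right hmD fun z hz =>
      hmax z (List.mem_append_right _ hz)
    have hC0 : C ≠ [] := fun hC => by simpa using h.nil_of_nil hC
    refine ⟨C, A, ?_, h.remove_right, ?_, fun i j k hj => ?_⟩
    · have := slide_shift A [] m [] (by simp)
      rw [dropEmpty_pair hC0 (by simp), slideOut, if_neg hmC, slideOut, if_pos hmD,
        idxOf_concat hA, this]
      simp
    · rw [← List.append_assoc]
      exact (List.perm_append_singleton m (C ++ A)).symm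
    · refine forall_congr' fun y => forall_congr' fun hy => forall_congr' fun hy' => ?_
      rw [cnt_concat, if_neg (by omega), add_zero]

theorem exists_foldl_remove_max {j d : ℕ} {C D : List ℕ} (h : IsStd C D)
    (hp : (C ++ D).Perm (List.range' 1 (j + d))) :
    ∃ C' D', (List.range' (j + 1) d).reverse.foldl jeuDeTaquinRemove (dropEmpty [C, D]) =
        dropEmpty [C', D'] ∧ IsStd C' D' ∧ (C' ++ D').Perm (List.range' 1 j) ∧
      ∀ i k, Bnd C' D' i (j + 1) k ↔ Bnd C D i (j + 1) k := by
  induction d generalizing C D with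
  | zero => exact ⟨C, D, rfl, h, hp, fun _ _ => Iff.rfl⟩
  | succ d ih =>
    have hmem : ∀ z, z ∈ C ++ D ↔ 1 ≤ z ∧ z < 1 + (j + (d + 1)) := fun z => by
      rw [hp.mem_iff, List.mem_range'_1]
    obtain ⟨C₁, D₁, heq, hstd, hperm, hbnd⟩ := exists_remove_max (m := j + 1 + d) h
      ((hmem _).2 (by omega)) fun z hz => by
        have := (hmem z).1 hz
        omega
    have hp₁ : (C₁ ++ D₁).Perm (List.range' 1 (j + d)) := by
      have h1 := hperm.trans hp
      rw [← add_assoc, List.range'_1_concat] at h1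
      have h2 : 1 + (j + d) = j + 1 + d := by omega
      rw [h2] at h1
      exact (h1.trans (List.perm_append_singleton _ _)).cons_inv
    obtain ⟨C', D', heq', hstd', hp', hbnd'⟩ := ih hstd hp₁
    refine ⟨C', D', ?_, hstd', hp', fun i k => (hbnd' i k).trans (hbnd i _ k (by omega))⟩
    rw [List.range'_1_concat, List.reverse_append, List.reverse_singleton, List.singleton_append,
      List.foldl_cons, heq, heq']

theorem exists_foldl_remove_min {a s l : ℕ} {C D : List ℕ} (h : IsStd C D)
    (hp : (C ++ D).Perm (List.range' a (s + l))) :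
    ∃ C' D', (List.range' a s).foldl jeuDeTaquinRemove (dropEmpty [C, D]) =
        dropEmpty [C', D'] ∧ IsStd C' D' ∧ (C' ++ D').Perm (List.range' (a + s) l) ∧
      ∀ j k, a + s ≤ j → (Bnd C' D' (a + s) j k ↔ Bnd C D (a + s) j k) := by
  induction s generalizing a C D with
  | zero => exact ⟨C, D, rfl, h, by simpa using hp, fun _ _ _ => Iff.rfl⟩
  | succ s ih =>
    have hmem : ∀ z, z ∈ C ++ D ↔ a ≤ z ∧ z < a + (s + 1 + l) := fun z => by
      rw [hp.mem_iff, List.mem_range'_1]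
    -- If `a` were in `D`, the ballot condition at `a + 1` would put it into `C` as well.
    have haC : a ∈ C := by
      refine (List.mem_append.1 ((hmem a).2 (by omega))).resolve_right fun haD => ?_
      have h1 : 0 < cnt C 0 (a + 1) :=
        (cnt_pos_iff.2 ⟨a, haD, by omega⟩ : 0 < cnt D 0 (a + 1)).trans_le (h.ballot _)
      obtain ⟨z, hz, hz'⟩ := cnt_pos_iff.1 h1
      have h2 := (hmem z).1 (List.mem_append_left _ hz)
      have h3 : z = a := by omega
      exact h.disjoint z hz (h3 ▸ haD)
    obtain ⟨B, rfl⟩ : ∃ B, C = a :: B := by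
      cases C with
      | nil => simp at haC
      | cons c B =>
        have h1 := (hmem c).1 (by simp)
        rcases List.mem_cons.1 haC with rfl | haB
        · exact ⟨B, rfl⟩
        · have := (List.pairwise_cons.1 h.left).1 a haB
          omega
    obtain ⟨C₁, D₁, heq, hstd, hperm, hbnd⟩ := exists_remove_min h
    have hp₁ : (C₁ ++ D₁).Perm (List.range' (a + 1) (s + l)) := by
      have h1 : s + 1 + l = s + l + 1 := by omega
      rw [h1, List.range'_succ, List.cons_append] at hp
      exact hperm.trans hp.cons_inv
    obtain ⟨C', D', heq', hstd', hp', hbnd'⟩ := ih hstd hp₁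
    have h2 : a + 1 + s = a + (s + 1) := by omega
    rw [h2] at hp' hbnd'
    refine ⟨C', D', ?_, hstd', hp', fun j k hj =>
      (hbnd' j k hj).trans (hbnd _ j k (by omega) hj)⟩
    rw [List.range'_succ, List.foldl_cons, heq, heq']

theorem StandardTableau.TwoColumn.exists_proj {n : ℕ} {T : StandardTableau n} (hT : T.TwoColumn)
    {i j : ℕ} (hi : 1 ≤ i) (hij : i ≤ j) (hj : j ≤ n) :
    ∃ C D, T.proj i j = dropEmpty [C, D] ∧ IsStd C D ∧ (C ++ D).Perm (List.range' i (j + 1 - i)) ∧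
      ∀ k, Bnd C D i (j + 1) k ↔ Bnd T.fst T.snd i (j + 1) k := by
  have hn : List.range' 1 n = List.range' 1 (j + (n - j)) := by
    congr 1
    omega
  obtain ⟨C₁, D₁, heq₁, hstd₁, hp₁, hbnd₁⟩ :=
    exists_foldl_remove_max hT.isStd (hT.perm.trans (.of_eq hn))
  rw [show j = (i - 1) + (j + 1 - i) by omega] at hp₁
  obtain ⟨C, D, heq, hstd, hp', hbnd⟩ := exists_foldl_remove_min hstd₁ hp₁
  rw [show 1 + (i - 1) = i by omega] at hp' hbnd
  refine ⟨C, D, ?_, hstd, hp', fun k => (hbnd _ k (by omega)).trans (hbnd₁ i k)⟩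
  rw [proj, List.foldl_append, hT.columns_eq, heq₁, heq]

/-! ### The chain order in terms of counts -/

/-- The cut `y = i` counts the whole first column, and by the ballot condition no other cut counts
more. -/
theorem IsStd.bnd_iff_length_le {C D : List ℕ} (h : IsStd C D) {i j k : ℕ} (hij : i ≤ j)
    (hmem : ∀ z ∈ C ++ D, i ≤ z ∧ z < j) : Bnd C D i j k ↔ C.length ≤ k := by
  have hC : cnt C i j = C.length := cnt_eq_length fun z hz => hmem z (List.mem_append_left _ hz)
  have h0 : ∀ E, (∀ z ∈ E, z ∈ C ++ D) → cnt E 0 i = 0 := fun E hE =>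
    cnt_eq_zero fun z hz _ => (hmem z (hE z hz)).1
  constructor
  · intro hb
    have := hb i le_rfl hij
    omega
  · intro hk y hiy hyj
    have h1 := h.ballot y
    have h2 := h0 C fun z hz => List.mem_append_left _ hz
    have h3 := h0 D fun z hz => List.mem_append_right _ hz
    have h4 := cnt_split C (Nat.zero_le i) hiy
    have h5 := cnt_split D (Nat.zero_le i) hiy
    have h6 := cnt_split C hiy hyj
    omega

theorem sum_take_shape {C D : List ℕ} (h : C = [] → D = []) (k : ℕ) :
    ((shape (dropEmpty [C, D])).take k).sum =
      if k = 0 then 0 else if k = 1 then C.length else C.length + D.length := by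
  by_cases hC : C = []
  · rw [hC, h hC]
    simp [dropEmpty, shape]
  · by_cases hD : D = []
    · subst hD
      rw [dropEmpty_single hC]
      match k with
      | 0 => simp
      | k + 1 => simp [shape]
    · rw [dropEmpty_pair hC hD]
      match k with
      | 0 => simp
      | 1 => simp [shape]
      | k + 2 => simp [shape]

/-- For equal sizes the partial sums can differ only at `k = 1`. -/
theorem dominanceLE_iff {C D C' D' : List ℕ} (h : C = [] → D = []) (h' : C' = [] → D' = [])
    (hlen : (C ++ D).length = (C' ++ D').length) :
    DominanceLE (shape (dropEmpty [C, D])) (shape (dropEmpty [C', D'])) ↔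
      C.length ≤ C'.length := by
  rw [List.length_append, List.length_append] at hlen
  simp only [DominanceLE, sum_take_shape h, sum_take_shape h']
  constructor
  · intro hk
    simpa using hk 1
  · intro hle k
    split_ifs <;> omega

/-- The chain order compares the lengths of the longest decreasing subsequences of words in the
two Young cells, restricted to intervals of letters. -/
theorem chainLE_iff {n : ℕ} {T S : StandardTableau n} (hT : T.TwoColumn) (hS : S.TwoColumn) :
    ChainLE T S ↔ ∀ i j, 1 ≤ i → i < j → j ≤ n → ∀ k,
      Bnd S.fst S.snd i (j + 1) k → Bnd T.fst T.snd i (j + 1) k := by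
  refine forall_congr' fun i => forall_congr' fun j => forall_congr' fun hi =>
    forall_congr' fun hij => forall_congr' fun hj => ?_
  obtain ⟨C, D, heq, hstd, hp, hb⟩ := hT.exists_proj hi hij.le hj
  obtain ⟨C', D', heq', hstd', hp', hb'⟩ := hS.exists_proj hi hij.le hj
  have hmem : ∀ z ∈ C ++ D, i ≤ z ∧ z < j + 1 := fun z hz => by
    have := List.mem_range'_1.1 (hp.subset hz)
    omega
  have hmem' : ∀ z ∈ C' ++ D', i ≤ z ∧ z < j + 1 := fun z hz => by
    have := List.mem_range'_1.1 (hp'.subset hz)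
    omega
  rw [heq, heq', dominanceLE_iff hstd.nil_of_nil hstd'.nil_of_nil (hp.trans hp'.symm).length_eq]
  simp only [← hb, ← hb', hstd.bnd_iff_length_le (show i ≤ j + 1 by omega) hmem,
    hstd'.bnd_iff_length_le (show i ≤ j + 1 by omega) hmem']
  exact ⟨fun h k hk => h.trans hk, fun h => h _ le_rfl⟩

/-! ### The canonical word -/

/-- `w` is the canonical word of the tableau with columns `C` and `D`. The entries pushed out are
the largest entry if it is in the first column, and otherwise first the last entry of the
first column and then the largest entry. -/
inductive IsCanonical : List ℕ → List ℕ → List ℕ → Prop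
  | nil : IsCanonical [] [] []
  | left {C D w : List ℕ} {z : ℕ} : IsCanonical C D w → (∀ x ∈ C, x < z) → (∀ x ∈ D, x < z) →
      IsCanonical (C ++ [z]) D (z :: w)
  | right {C D w : List ℕ} {c z : ℕ} : IsCanonical C D w → (∀ x ∈ C, x < c) → (∀ x ∈ D, x < z) →
      c < z → IsCanonical (C ++ [c]) (D ++ [z]) (c :: z :: w)

theorem IsStd.exists_isCanonical {C D : List ℕ} (h : IsStd C D) : ∃ w, IsCanonical C D w := by
  induction hl : (C ++ D).length using Nat.strong_induction_on generalizing C D with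
  | _ l ih =>
    rcases List.eq_nil_or_concat C with rfl | ⟨C, c, rfl⟩
    · rw [h.nil_of_nil rfl]
      exact ⟨[], .nil⟩
    · rw [List.concat_eq_append] at *
      have hC : ∀ x ∈ C, x < c := fun x hx =>
        (List.pairwise_append.1 h.left).2.2 x hx c (by simp)
      by_cases hD : ∀ x ∈ D, x < c
      · obtain ⟨w, hw⟩ := ih (C ++ D).length (by simp at hl ⊢; omega) (h.remove_left hD) rfl
        exact ⟨c :: w, hw.left hC hD⟩
      · rcases List.eq_nil_or_concat D with rfl | ⟨D, z, rfl⟩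
        · simp at hD
        · rw [List.concat_eq_append] at *
          have hDz : ∀ x ∈ D, x < z := fun x hx =>
            (List.pairwise_append.1 h.right).2.2 x hx z (by simp)
          have hcz : c < z := by
            have hne : c ≠ z := fun hcz => h.disjoint c (by simp) (by simp [hcz])
            by_contra hcz
            refine hD fun x hx => ?_
            rcases List.mem_append.1 hx with hx | hx
            · have := hDz x hx
              omega
            · have := List.mem_singleton.1 hx
              omega
          have hstd : IsStd C D := by
            refine ⟨(List.pairwise_append.1 h.left).1, (List.pairwise_append.1 h.right).1,
              fun x hx hxD => h.disjoint x (by simp [hx]) (by simp [hxD]), fun y => ?_⟩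
            have hlen := h.length_le
            have hy := h.ballot y
            rw [cnt_concat, cnt_concat] at hy
            simp only [List.length_append, List.length_singleton] at hlen
            -- Above `c` all of `C` is counted and comparing lengths suffices; otherwise neither
            -- removed entry is counted.
            by_cases hcy : c < y
            · rw [cnt_zero_eq_length fun x hx => (hC x hx).trans hcy]
              exact (List.countP_le_length).trans (by omega)
            · rw [if_neg (by omega), if_neg (by omega)] at hy
              exact hy
          obtain ⟨w, hw⟩ := ih (C ++ D).length (by simp at hl ⊢; omega) hstd rfl
          exact ⟨c :: z :: w, hw.right hC hDz hcz⟩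

theorem IsCanonical.perm {C D w : List ℕ} (h : IsCanonical C D w) : (C ++ D).Perm w := by
  induction h with
  | nil => rfl
  | left _ _ _ ih =>
    rw [List.append_assoc, List.singleton_append]
    exact List.perm_middle.trans (ih.cons _)
  | @right C D w c z _ _ _ _ ih =>
    rw [List.append_assoc, List.singleton_append]
    refine List.perm_middle.trans (List.Perm.cons c ?_)
    rw [← List.append_assoc]
    exact (List.perm_append_singleton _ _).trans (ih.cons z)

theorem IsCanonical.nil_of_nil {C D w : List ℕ} (h : IsCanonical C D w) (hC : C = []) :
    D = [] := by
  cases h with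
  | nil => rfl
  | left => simp at hC
  | right => simp at hC

theorem replace_concat {C : List ℕ} {c z : ℕ} (hC : c ∉ C) :
    (C ++ [c]).replace c z = C ++ [z] := by
  rw [List.replace_append, if_neg hC]
  simp

/-- For a pair `c, z`, first `z` lands at the bottom of the first column, then `c` bumps it into the
second. -/
theorem IsCanonical.insertionTableau_eq {C D w : List ℕ} (h : IsCanonical C D w) :
    insertionTableau w = dropEmpty [C, D] := by
  induction h with
  | nil => rfl
  | @left C D w z hw hC hD ih =>
    have heq : insertionTableau (z :: w) = tableauInsert z (insertionTableau w) := rfl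
    rw [heq, ih, tableauInsert_append (fun x hx => (hC x hx).le.not_gt) hw.nil_of_nil]
  | @right C D w c z hw hC hD hcz ih =>
    have heq : insertionTableau (c :: z :: w) =
      tableauInsert c (tableauInsert z (insertionTableau w)) := rfl
    have hCz : ∀ x ∈ C, x < z := fun x hx => (hC x hx).trans hcz
    rw [heq, ih, tableauInsert_append (fun x hx => (hCz x hx).le.not_gt) hw.nil_of_nil,
      tableauInsert_bump (b := z) (by simp) hcz ?_ fun x hx => (hD x hx).le.not_gt,
      replace_concat fun hz => lt_irrefl z (hCz z hz)]
    intro x hx hcx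
    rcases List.mem_append.1 hx with hx | hx
    · have := hC x hx
      omega
    · exact (List.mem_singleton.1 hx).ge

theorem canonicalLetters_succ {k z : ℕ} {T : List (List ℕ)} (hz : z ∈ T.flatten)
    (hmax : ∀ x ∈ T.flatten, x ≤ z) :
    canonicalLetters (k + 1) T =
      (deleteCorner z T).2 :: canonicalLetters k (dropEmpty (deleteCorner z T).1) := by
  have : T.flatten.max? = some z := by
    rw [List.max?_eq_some_iff]
    exact ⟨hz, hmax⟩
  simp only [canonicalLetters, this]

theorem erase_concat {C : List ℕ} {z : ℕ} (hC : z ∉ C) : (C ++ [z]).erase z = C := by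
  rw [List.erase_append_right _ hC]
  simp

theorem canonicalLetters_left {k z : ℕ} {C D : List ℕ} (hC : ∀ x ∈ C, x < z)
    (hD : ∀ x ∈ D, x < z) :
    canonicalLetters (k + 1) (dropEmpty [C ++ [z], D]) =
      z :: canonicalLetters k (dropEmpty [C, D]) := by
  have hflat : (dropEmpty [C ++ [z], D]).flatten = C ++ z :: D := by
    rw [flatten_dropEmpty]
    simp
  rw [canonicalLetters_succ (z := z) (by simp [hflat])]
  · have hzC : z ∉ C := fun hz => lt_irrefl z (hC z hz)
    by_cases hD0 : D = []
    · subst hD0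
      rw [dropEmpty_single (by simp), deleteCorner, if_pos (by simp), erase_concat hzC]
      simp [dropEmpty, List.filter_cons]
    · rw [dropEmpty_pair (by simp) hD0, deleteCorner, if_pos (by simp), erase_concat hzC]
  · rw [hflat]
    intro x hx
    simp only [List.mem_append, List.mem_cons] at hx
    rcases hx with hx | rfl | hx
    · exact (hC x hx).le
    · exact le_rfl
    · exact (hD x hx).le

theorem canonicalLetters_right {k c z : ℕ} {C D : List ℕ} (hC : ∀ x ∈ C, x < c)
    (hD : ∀ x ∈ D, x < z) (hcz : c < z) :
    canonicalLetters (k + 1) (dropEmpty [C ++ [c], D ++ [z]]) =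
      c :: canonicalLetters k (dropEmpty [C ++ [z], D]) := by
  have hCz : ∀ x ∈ C ++ [c], x < z := by
    intro x hx
    rcases List.mem_append.1 hx with hx | hx
    · exact (hC x hx).trans hcz
    · exact (List.mem_singleton.1 hx) ▸ hcz
  have hcC : c ∉ C := fun hc => lt_irrefl c (hC c hc)
  rw [dropEmpty_pair (by simp) (by simp), canonicalLetters_succ (z := z) (by simp)]
  · have hpush : pushLeft (C ++ [c]) z = (C ++ [z], c) := by
      have hfil : ((C ++ [c]).filter fun a => decide (a < z)) = C ++ [c] :=
        List.filter_eq_self.2 fun x hx => by simpa using hCz x hx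
      have : (C ++ [c]).max? = some c := by
        rw [List.max?_eq_some_iff]
        refine ⟨by simp, fun x hx => ?_⟩
        rcases List.mem_append.1 hx with hx | hx
        · exact (hC x hx).le
        · exact (List.mem_singleton.1 hx).le
      rw [pushLeft, hfil, this]
      simp only [replace_concat hcC]
    have hdel : deleteCorner z [D ++ [z]] = ([D], z) := by
      rw [deleteCorner, if_pos (by simp), erase_concat fun hz => lt_irrefl z (hD z hz)]
    rw [deleteCorner, if_neg fun hz => lt_irrefl z (hCz z hz), hdel, hpush]
  · intro x hx
    simp only [List.flatten_cons, List.flatten_nil, List.append_nil] at hx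
    rcases List.mem_append.1 hx with hx | hx
    · exact (hCz x hx).le
    · rcases List.mem_append.1 hx with hx | hx
      · exact (hD x hx).le
      · exact (List.mem_singleton.1 hx).le

theorem IsCanonical.canonicalLetters_eq {C D w : List ℕ} (h : IsCanonical C D w) :
    canonicalLetters w.length (dropEmpty [C, D]) = w := by
  induction h with
  | nil => rfl
  | left _ hC hD ih => rw [List.length_cons, canonicalLetters_left hC hD, ih]
  | right _ hC hD hcz ih =>
    rw [List.length_cons, List.length_cons, canonicalLetters_right hC hD hcz,
      canonicalLetters_left (fun x hx => (hC x hx).trans hcz) hD, ih]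

/-- The increasing pairs in the canonical word. -/
theorem IsCanonical.pair_sublist_iff {C D w : List ℕ} (h : IsCanonical C D w) {p q : ℕ}
    (hpq : p < q) :
    [p, q].Sublist w ↔ p ∈ C ∧ q ∈ D ∧ ∃ e, q < e ∧ cnt C p e ≤ cnt D q e := by
  induction h with
  | nil => simp
  | @left C D w z hw hC hD ih =>
    have hmem : ∀ x, x ∈ w ↔ x ∈ C ∨ x ∈ D := fun x => by
      rw [← hw.perm.mem_iff, List.mem_append]
    rw [pair_sublist_cons, ih, List.mem_append, List.mem_singleton]
    constructor
    · rintro (⟨hp, hq, e, hqe, hle⟩ | ⟨rfl, hq⟩)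
      · have hqz := hD q hq
        -- Stopping at `z` keeps the new entry out of the left count and loses nothing of `D`.
        refine ⟨Or.inl hp, hq, min e z, by omega, ?_⟩
        rw [cnt_concat, if_neg (by omega)]
        rcases le_total e z with hez | hez
        · rwa [min_eq_left hez]
        · rw [min_eq_right hez]
          have h1 := cnt_split C (show p ≤ z by omega) hez
          have h2 := cnt_split D hqz.le hez
          have h3 : cnt D z e = 0 := cnt_eq_zero fun x hx hzx => by
            have := hD x hx
            omega
          omega
      · exfalso
        rcases (hmem q).1 hq with hq | hq
        · have := hC q hq
          omega
        · have := hD q hq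
          omega
    · rintro ⟨hp, hq, e, hqe, hle⟩
      have hqz := hD q hq
      refine Or.inl ⟨hp.resolve_right (by omega), hq, e, hqe, ?_⟩
      rw [cnt_concat] at hle
      omega
  | @right C D w c z hw hC hD hcz ih =>
    have hmem : ∀ x, x ∈ w ↔ x ∈ C ∨ x ∈ D := fun x => by
      rw [← hw.perm.mem_iff, List.mem_append]
    have hCe : ∀ x e, c ≤ x → cnt C x e = 0 := fun x e hcx => cnt_eq_zero fun y hy hxy => by
      have := hC y hy
      omega
    have hDe : ∀ e, cnt D z e = 0 := fun e => cnt_eq_zero fun y hy hxy => by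
      have := hD y hy
      omega
    rw [pair_sublist_cons, pair_sublist_cons, ih, List.mem_append, List.mem_append,
      List.mem_singleton, List.mem_singleton, List.mem_cons]
    constructor
    · rintro ((⟨hp, hq, e, hqe, hle⟩ | ⟨rfl, hq⟩) | ⟨rfl, hq⟩)
      · have hpc := hC p hp
        have hqz := hD q hq
        by_cases hec : e ≤ c
        · refine ⟨Or.inl hp, Or.inl hq, e, hqe, ?_⟩
          rw [cnt_concat, cnt_concat, if_neg (by omega), if_neg (by omega)]
          omega
        -- With `z + 1` the new entries `c` and `z` contribute one to each side.
        · refine ⟨Or.inl hp, Or.inl hq, z + 1, by omega, ?_⟩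
          rw [cnt_concat, cnt_concat, if_pos (by omega), if_pos (by omega)]
          have h1 := cnt_split C hpc.le (show c ≤ e by omega)
          have h2 := cnt_split C hpc.le (show c ≤ z + 1 by omega)
          have h3 := hCe c (z + 1) le_rfl
          have h4 := cnt_split D hqz.le (show z ≤ z + 1 by omega)
          have h5 : cnt D q e ≤ cnt D q z := by
            rcases le_total e z with hez | hez
            · exact cnt_mono D le_rfl hez
            · have h6 := cnt_split D hqz.le hez
              have h7 := hDe e
              omega
          omega
      · exfalso
        rcases (hmem q).1 hq with hq | hq
        · have := hC q hq
          omega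
        · have := hD q hq
          omega
      · have hqD : q ∈ D ∨ q = z := by
          rcases hq with hq | hq
          · exact Or.inr hq
          · refine Or.inl (((hmem q).1 hq).resolve_left fun hq => ?_)
            have := hC q hq
            omega
        have hqz : q ≤ z := by
          rcases hqD with hq | hq
          · exact (hD q hq).le
          · exact hq.le
        refine ⟨Or.inr rfl, hqD, z + 1, by omega, ?_⟩
        rw [cnt_concat, cnt_concat, if_pos (by omega), if_pos (by omega), hCe p _ le_rfl]
        omega
    · rintro ⟨hp, hq, e, hqe, hle⟩
      rw [cnt_concat, cnt_concat] at hle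
      by_cases hpc : p = c
      · refine Or.inr ⟨hpc, ?_⟩
        rcases hq with hq | hq
        · exact Or.inr ((hmem q).2 (Or.inr hq))
        · exact Or.inl hq
      · have hpC := hp.resolve_right hpc
        have hpc' := hC p hpC
        have hcp : 0 < cnt C p c := cnt_pos_iff.2 ⟨p, hpC, le_rfl, hpc'⟩
        rcases hq with hq | rfl
        · have hqz := hD q hq
          refine Or.inl (Or.inl ⟨hpC, hq, ?_⟩)
          by_cases hec : c < e
          · refine ⟨max e z, by omega, ?_⟩
            have h1 := cnt_split C hpc'.le hec.le
            have h2 := cnt_split C hpc'.le (show c ≤ max e z by omega)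
            have h3 := hCe c (max e z) le_rfl
            have h4 := cnt_mono D (le_refl q) (le_max_left e z)
            split_ifs at hle <;> omega
          · refine ⟨e, hqe, ?_⟩
            split_ifs at hle <;> omega
        -- For `q = z` the right count is at most one, while `p` and `c` both count on the left.
        · exfalso
          have h1 := cnt_split C hpc'.le (show c ≤ e by omega)
          have h2 := hDe e
          rw [if_pos (by omega)] at hle
          split_ifs at hle <;> omega

theorem StandardTableau.TwoColumn.isCanonical {n : ℕ} {T : StandardTableau n} (hT : T.TwoColumn) :
    IsCanonical T.fst T.snd T.canonicalWord.letters := by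
  obtain ⟨w, hw⟩ := hT.isStd.exists_isCanonical
  have hlen : w.length = n := by
    rw [← hw.perm.length_eq, hT.perm.length_eq, List.length_range']
  have : T.canonicalWord.letters = w := by
    rw [← hw.canonicalLetters_eq, hlen, ← hT.columns_eq]
    rfl
  rwa [this]

theorem StandardTableau.TwoColumn.canonicalWord_mem {n : ℕ} {T : StandardTableau n}
    (hT : T.TwoColumn) : T.canonicalWord ∈ youngCell T :=
  hT.isCanonical.insertionTableau_eq.trans hT.columns_eq.symm

/-! ### Comparison of the orders -/

/-- An increasing subsequence of `y` is one of `w`, so none with three letters can appear. This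
controls the intermediate tableaux of a Duflo chain, which are otherwise arbitrary. -/
theorem DufloStep.twoColumn {n : ℕ} {T S : StandardTableau n} (h : DufloStep T S)
    (hT : T.TwoColumn) : S.TwoColumn := by
  obtain ⟨w, hw, y, hy, hwy⟩ := h
  have hw' : insertionTableau w.letters = T.columns := hw
  have hy' : insertionTableau y.letters = S.columns := hy
  unfold StandardTableau.TwoColumn at *
  rw [← hw', insertionTableau_length_le_two_iff w.nodup] at hT
  rw [← hy', insertionTableau_length_le_two_iff y.nodup]
  intro p q r hpq hqr hs
  refine hT p q r hpq hqr (hwy.increasing_sublist ?_ hs)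
  simp
  omega

theorem StandardTableau.TwoColumn.bnd_iff {n : ℕ} {T : StandardTableau n} (hT : T.TwoColumn)
    {w : Word n} (hw : w ∈ youngCell T) {i j k : ℕ} (hij : i ≤ j) :
    Bnd T.fst T.snd i j k ↔ decLength w.letters i j ≤ k := by
  have hw' : insertionTableau w.letters = T.columns := hw
  obtain ⟨C, D, hins, hCD, heq⟩ := exists_inserts w.nodup (hw' ▸ hT)
  have h1 := getD_dropEmpty hCD
  rw [← heq, hw'] at h1
  rw [← hins.bnd_iff w.nodup hij, ← h1.1, ← h1.2]
  rfl

theorem DufloLE.twoColumn_and_bnd {n : ℕ} {T S : StandardTableau n} (h : DufloLE T S)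
    (hT : T.TwoColumn) : S.TwoColumn ∧ ∀ i j k, i ≤ j →
      Bnd S.fst S.snd i j k → Bnd T.fst T.snd i j k := by
  induction h with
  | refl => exact ⟨hT, fun _ _ _ _ h => h⟩
  | tail _ hstep ih =>
    have hS := hstep.twoColumn ih.1
    refine ⟨hS, fun i j k hij hb => ih.2 i j k hij ?_⟩
    obtain ⟨w, hw, y, hy, hwy⟩ := hstep
    rw [ih.1.bnd_iff hw hij]
    exact (hwy.decLength_le i j).trans ((hS.bnd_iff hy hij).1 hb)

/-! ### From the chain order to the weak order of canonical words -/

theorem StandardTableau.TwoColumn.cnt_add {n : ℕ} {T : StandardTableau n} (hT : T.TwoColumn)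
    {i j : ℕ} (hi : 1 ≤ i) (hij : i ≤ j) (hj : j ≤ n + 1) :
    cnt T.fst i j + cnt T.snd i j = j - i := by
  have hr : ∀ m, cnt (List.range' 1 m) i j = min j (m + 1) - min i (m + 1) := fun m => by
    induction m with
    | zero =>
      simp
      omega
    | succ m ih =>
      rw [List.range'_1_concat, cnt_concat, ih]
      split_ifs <;> omega
  rw [← cnt_append, cnt_perm hT.perm, hr]
  omega

theorem StandardTableau.TwoColumn.mem_or {n : ℕ} {T : StandardTableau n} (hT : T.TwoColumn)
    {m : ℕ} : m ∈ T.fst ∨ m ∈ T.snd ↔ 1 ≤ m ∧ m ≤ n := by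
  rw [← List.mem_append, hT.perm.mem_iff, List.mem_range'_1]
  omega

theorem IsStd.cnt_succ_le_one {C D : List ℕ} (h : IsStd C D) (m : ℕ) :
    cnt C m (m + 1) ≤ 1 ∧ cnt D m (m + 1) ≤ 1 :=
  ⟨YoungOrder.cnt_succ_le_one (h.left.imp fun h => h.ne) m,
    YoungOrder.cnt_succ_le_one (h.right.imp fun h => h.ne) m⟩

theorem cnt_succ_pos {C : List ℕ} {m : ℕ} (hm : m ∈ C) : 0 < cnt C m (m + 1) :=
  cnt_pos_iff.2 ⟨m, hm, le_rfl, Nat.lt_succ_self m⟩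

theorem cnt_succ_eq_zero {C : List ℕ} {m : ℕ} (hm : m ∉ C) : cnt C m (m + 1) = 0 :=
  cnt_eq_zero fun _ hz hmz => Nat.succ_le_of_lt (lt_of_le_of_ne hmz fun h => hm (h ▸ hz))

/-- Take the shortest interval `[x, m]` in which the columns of `S` have equally many entries, say
`k`. Minimality bounds every cut of `S` by `k`, hence every cut of `T`. This leaves no room for `m`
in the first column of `T`. -/
theorem mem_snd_of_bnd {n : ℕ} {T S : StandardTableau n} (hT : T.TwoColumn) (hS : S.TwoColumn)
    (h : ∀ i j, 1 ≤ i → i < j → j ≤ n → ∀ k,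
      Bnd S.fst S.snd i (j + 1) k → Bnd T.fst T.snd i (j + 1) k)
    {m : ℕ} (hm : m ∈ S.snd) : m ∈ T.snd := by
  have hstd := hS.isStd
  have hmn := hS.mem_or.1 (Or.inr hm)
  have hmC : m ∉ S.fst := fun hmC => hstd.disjoint m hmC hm
  have hpos := cnt_succ_pos hm
  have hzero := cnt_succ_eq_zero hmC
  let P : ℕ → Prop := fun x => cnt S.snd x (m + 1) ≤ cnt S.fst x (m + 1)
  -- No entry is below `1`, so this is the ballot condition at `m + 1`.
  have hP1 : P 1 := by
    have h0 : ∀ E : List ℕ, (∀ z ∈ E, z ∈ S.fst ∨ z ∈ S.snd) → cnt E 0 1 = 0 := fun E hE =>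
      cnt_eq_zero fun z hz _ => (hS.mem_or.1 (hE z hz)).1
    have h1 := h0 S.fst fun _ => Or.inl
    have h2 := h0 S.snd fun _ => Or.inr
    have h3 := cnt_split S.fst (show 0 ≤ 1 by omega) (show 1 ≤ m + 1 by omega)
    have h4 := cnt_split S.snd (show 0 ≤ 1 by omega) (show 1 ≤ m + 1 by omega)
    have h5 := hstd.ballot (m + 1)
    change _ ≤ _
    omega
  classical
  obtain ⟨x, hx⟩ : ∃ x, x = Nat.findGreatest P m := ⟨_, rfl⟩
  have hPx : P x := hx ▸ Nat.findGreatest_spec hmn.1 hP1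
  have hx1 : 1 ≤ x := hx ▸ Nat.le_findGreatest hmn.1 hP1
  have hxm : x ≤ m := hx ▸ Nat.findGreatest_le m
  have hgt : ∀ y, x < y → y ≤ m → cnt S.fst y (m + 1) < cnt S.snd y (m + 1) := fun y hxy hym =>
    not_le.1 (Nat.findGreatest_is_greatest (P := P) (hx ▸ hxy) hym)
  have hPx' : cnt S.snd x (m + 1) ≤ cnt S.fst x (m + 1) := hPx
  have hxm' : x < m := by
    refine lt_of_le_of_ne hxm fun hxm => ?_
    subst hxm
    omega
  have hfst : cnt S.fst x (m + 1) ≤ cnt S.snd x (m + 1) := by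
    have h1 := hgt (x + 1) (by omega) (by omega)
    have h2 := cnt_split S.fst (show x ≤ x + 1 by omega) (show x + 1 ≤ m + 1 by omega)
    have h3 := (hstd.cnt_succ_le_one x).1
    have h4 := cnt_mono S.snd (show x ≤ x + 1 by omega) (le_refl (m + 1))
    omega
  have hb : Bnd S.fst S.snd x (m + 1) (cnt S.snd x (m + 1)) := by
    intro y hxy hym
    have h1 := cnt_split S.snd hxy hym
    rcases eq_or_lt_of_le hxy with rfl | hxy
    · rw [cnt_self]
      exact hfst
    · rcases eq_or_lt_of_le hym with rfl | hym
      · rw [cnt_self]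
        omega
      · have := hgt y hxy (by omega)
        omega
  have hbT := h x m hx1 hxm' hmn.2 _ hb
  by_contra hmT
  have hmT' := (hT.mem_or.2 hmn).resolve_right hmT
  have h1 := hT.cnt_add hx1 (show x ≤ m + 1 by omega) (by omega)
  have h2 := hS.cnt_add hx1 (show x ≤ m + 1 by omega) (by omega)
  -- The cut `x` leaves at least half of the letters to `T.snd`; the cut `m` counts `m` on top of
  -- them.
  have h3 := hbT x le_rfl (by omega)
  have h4 := hbT m hxm (by omega)
  have h5 := cnt_split T.snd hxm (Nat.le_succ m)
  have h6 := cnt_succ_eq_zero hmT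
  have h7 := cnt_succ_pos hmT'
  simp only [Nat.succ_eq_add_one] at h5
  omega

theorem StandardTableau.TwoColumn.cnt_eq_of_gt {n : ℕ} {S : StandardTableau n} (hS : S.TwoColumn)
    {m e : ℕ} (hm : m ≤ n + 1) (he : n + 1 ≤ e) :
    cnt S.fst m e = cnt S.fst m (n + 1) ∧ cnt S.snd m e = cnt S.snd m (n + 1) := by
  have h0 : ∀ E : List ℕ, (∀ z ∈ E, z ∈ S.fst ∨ z ∈ S.snd) → cnt E (n + 1) e = 0 := fun E hE =>
    cnt_eq_zero fun z hz hz' => by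
      have := hS.mem_or.1 (hE z hz)
      omega
  have h1 := h0 S.fst fun _ => Or.inl
  have h2 := h0 S.snd fun _ => Or.inr
  have h3 := cnt_split S.fst hm he
  have h4 := cnt_split S.snd hm he
  omega

/-- The mirror image of `mem_snd_of_bnd`, with a balanced interval that starts at `m`. The ballot
condition does not provide its upper end, so `hle` is assumed. -/
theorem mem_fst_of_bnd {n : ℕ} {T S : StandardTableau n} (hT : T.TwoColumn) (hS : S.TwoColumn)
    (h : ∀ i j, 1 ≤ i → i < j → j ≤ n → ∀ k,
      Bnd S.fst S.snd i (j + 1) k → Bnd T.fst T.snd i (j + 1) k)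
    {m e : ℕ} (hm : m ∈ S.fst) (he : m < e) (hle : cnt S.fst m e ≤ cnt S.snd m e) :
    m ∈ T.fst := by
  have hstd := hS.isStd
  have hmn := hS.mem_or.1 (Or.inl hm)
  have hmD := hstd.disjoint m hm
  have hpos := cnt_succ_pos hm
  have hzero := cnt_succ_eq_zero hmD
  classical
  have hex : ∃ e, m < e ∧ cnt S.fst m e ≤ cnt S.snd m e := ⟨e, he, hle⟩
  obtain ⟨f, hf⟩ : ∃ f, f = Nat.find hex := ⟨_, rfl⟩
  obtain ⟨hmf, hfle⟩ : m < f ∧ cnt S.fst m f ≤ cnt S.snd m f := hf ▸ Nat.find_spec hex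
  have hmin : ∀ y, m < y → y < f → cnt S.snd m y < cnt S.fst m y := fun y hmy hyf =>
    not_le.1 fun hy => Nat.find_min hex (hf ▸ hyf) ⟨hmy, hy⟩
  have hfn : f ≤ n + 1 := by
    by_contra hfn
    have h1 := hS.cnt_eq_of_gt (show m ≤ n + 1 by omega) (show n + 1 ≤ f by omega)
    have h2 := hmin (n + 1) (by omega) (by omega)
    omega
  obtain ⟨g, rfl⟩ : ∃ g, f = g + 1 := ⟨f - 1, by omega⟩
  have hmg : m < g := by
    refine lt_of_le_of_ne (by omega) fun hmg => ?_
    subst hmg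
    omega
  have hsnd : cnt S.snd m (g + 1) ≤ cnt S.fst m (g + 1) := by
    have h1 := hmin g hmg (by omega)
    have h2 := cnt_split S.snd hmg.le (Nat.le_succ g)
    have h3 := (hstd.cnt_succ_le_one g).2
    have h4 := cnt_mono S.fst (le_refl m) (Nat.le_succ g)
    simp only [Nat.succ_eq_add_one] at h2 h4
    omega
  have hb : Bnd S.fst S.snd m (g + 1) (cnt S.fst m (g + 1)) := by
    intro y hmy hyg
    have h1 := cnt_split S.fst hmy hyg
    rcases eq_or_lt_of_le hmy with rfl | hmy
    · rw [cnt_self]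
      omega
    · rcases eq_or_lt_of_le hyg with rfl | hyg
      · rw [cnt_self]
        omega
      · have := hmin y hmy hyg
        omega
  have hbT := h m g hmn.1 hmg (by omega) _ hb
  by_contra hmT
  have hmT' := (hT.mem_or.2 hmn).resolve_left hmT
  have h1 := hT.cnt_add hmn.1 (show m ≤ g + 1 by omega) hfn
  have h2 := hS.cnt_add hmn.1 (show m ≤ g + 1 by omega) hfn
  have h3 := hbT (g + 1) (by omega) le_rfl
  have h4 := hbT (m + 1) (by omega) (by omega)
  have h5 := cnt_split T.fst (Nat.le_succ m) (show m + 1 ≤ g + 1 by omega)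
  have h6 := cnt_succ_eq_zero hmT
  have h7 := cnt_succ_pos hmT'
  simp only [Nat.succ_eq_add_one] at h5
  omega

theorem cnt_le_of_subset {C D : List ℕ} (hC : C.Nodup) (h : ∀ z ∈ C, z ∈ D) (a b : ℕ) :
    cnt C a b ≤ cnt D a b :=
  (hC.subperm h).countP_le _

/-- Since `S.snd` is contained in `T.snd`, passing to `T` can only raise the counts of the second
column and lower the complementary counts of the first. Hence the counting inequality for a
non-inversion survives. -/
theorem weakLE_canonicalWord_of_bnd {n : ℕ} {T S : StandardTableau n} (hT : T.TwoColumn) (hS : S.TwoColumn)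
    (h : ∀ i j, 1 ≤ i → i < j → j ≤ n → ∀ k,
      Bnd S.fst S.snd i (j + 1) k → Bnd T.fst T.snd i (j + 1) k) :
    WeakLE T.canonicalWord S.canonicalWord := by
  rw [weakLE_iff_sublist]
  intro p q hpq hs
  obtain ⟨hp, hq, e, hqe, hle⟩ := (hS.isCanonical.pair_sublist_iff hpq).1 hs
  have hpn := hS.mem_or.1 (Or.inl hp)
  have hqn := hS.mem_or.1 (Or.inr hq)
  -- The two counts are complementary only up to `n + 1`, so a larger witness is cut down to it.
  obtain ⟨f, hqf, hfn, hle⟩ :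
      ∃ f, q < f ∧ f ≤ n + 1 ∧ cnt S.fst p f ≤ cnt S.snd q f := by
    rcases le_total e (n + 1) with hen | hen
    · exact ⟨e, hqe, hen, hle⟩
    · refine ⟨n + 1, by omega, le_rfl, ?_⟩
      have h1 := hS.cnt_eq_of_gt (show p ≤ n + 1 by omega) hen
      have h2 := hS.cnt_eq_of_gt (show q ≤ n + 1 by omega) hen
      omega
  have hsub := cnt_le_of_subset (hS.isStd.right.imp fun h => h.ne)
    fun _ hz => mem_snd_of_bnd hT hS h hz
  refine (hT.isCanonical.pair_sublist_iff hpq).2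
    ⟨mem_fst_of_bnd hT hS h hp (hpq.trans hqf) ?_, mem_snd_of_bnd hT hS h hq, f, hqf, ?_⟩
  · exact hle.trans (cnt_mono _ hpq.le le_rfl)
  · have h1 := hT.cnt_add hpn.1 (show p ≤ f by omega) hfn
    have h2 := hS.cnt_add hpn.1 (show p ≤ f by omega) hfn
    have h3 := hsub p f
    have h4 := hsub q f
    omega

end YoungOrder

theorem corollary3p14 (n : ℕ) (T S : YoungOrder.StandardTableau n)
    (hT : T.TwoColumn) (hS : S.TwoColumn) :
    (YoungOrder.DufloLE T S ↔ YoungOrder.WeakLE T.canonicalWord S.canonicalWord) ∧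
    ((YoungOrder.DufloLE T S ∧ T ≠ S) ↔
      (YoungOrder.WeakLE T.canonicalWord S.canonicalWord ∧
        T.canonicalWord ≠ S.canonicalWord)) ∧
    (YoungOrder.DufloLE T S ↔ YoungOrder.ChainLE T S) := by
  open YoungOrder in
  have hDC : DufloLE T S → ChainLE T S := fun h => (chainLE_iff hT hS).2
    fun i j _ hij _ k => (h.twoColumn_and_bnd hT).2 i (j + 1) k (by omega)
  have hCW : ChainLE T S → WeakLE T.canonicalWord S.canonicalWord := fun h =>
    weakLE_canonicalWord_of_bnd hT hS ((chainLE_iff hT hS).1 h)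
  have hWD : WeakLE T.canonicalWord S.canonicalWord → DufloLE T S := fun h =>
    .single ⟨_, hT.canonicalWord_mem, _, hS.canonicalWord_mem, h⟩
  have hinj : T.canonicalWord = S.canonicalWord ↔ T = S := by
    refine ⟨fun h => ?_, fun h => h ▸ rfl⟩
    have h1 : insertionTableau T.canonicalWord.letters = T.columns := hT.canonicalWord_mem
    have h2 : insertionTableau S.canonicalWord.letters = S.columns := hS.canonicalWord_mem
    exact StandardTableau.ext (by rw [← h1, ← h2, h])
  have hDW : DufloLE T S ↔ WeakLE T.canonicalWord S.canonicalWord :=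
    ⟨fun h => hCW (hDC h), hWD⟩
  exact ⟨hDW, and_congr hDW (not_congr hinj.symm), hDC, fun h => hWD (hCW h)⟩
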